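/- **Weak maximum principle for $p$-harmonic maps.** Let $(M,g)$ be a compact smooth Riemannian manifold of dimension $m\ge 1$ with smooth boundary $\partial M\neq\emptyset$, such that every connected component of $M$ meets $\partial M$ (for instance, $M$ connected), and let $(N,h)$ be a smooth Riemannian manifold without boundary. Let $p\ge 2$ be a real number and let $u\in C^1(M,N)$ be a $p$-harmonic map, that is, $$\int_M \big\langle |du|^{p-2}\,du,\; dX\big\rangle_{HS}\, dV_M = 0$$ for every $C^1$ vector field $X$ along $u$ (a $C^1$ section of $u^{-1}TN$) with compact support in the interior of $M$. Here $dV_M$ is the Riemannian volume measure, $dX$ is the covariant differential of $X$ with respect to the pull-back to $u^{-1}TN$ of the Levi-Civita connection of $N$, and $|\cdot|$ and $\langle\cdot,\cdot\rangle_{HS}$ are the Hilbert–Schmidt norm and product on $T^*M\otimes u^{-1}TN$. Let $f:N\to\mathbb{R}$ be a smooth convex function, that is, a $C^\infty$ function whose Riemannian Hessian $\operatorname{Hess} f$ is positive semidefinite at every point, and set $w=f\circ u:M\to\mathbb{R}$. Then $w$ is bounded above and $$\sup_M w=\sup_{\partial M} w .$$ -/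

import Mathlib

open Bundle Manifold MeasureTheory Set
open scoped ContDiff Topology

noncomputable section

/-! ### Hilbert–Schmidt product of linear maps -/

section HilbertSchmidt

variable {V W : Type*} [NormedAddCommGroup V] [InnerProductSpace ℝ V] [FiniteDimensional ℝ V]
  [NormedAddCommGroup W] [InnerProductSpace ℝ W]

/-- The Hilbert–Schmidt product `∑ i, ⟪A eᵢ, B eᵢ⟫` of two linear maps, where `(eᵢ)` is an
orthonormal basis of the source. -/
def hsInner (A B : V →ₗ[ℝ] W) : ℝ :=
  ∑ i, inner ℝ (A (stdOrthonormalBasis ℝ V i)) (B (stdOrthonormalBasis ℝ V i))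

/-- The Hilbert–Schmidt product may be computed in any orthonormal basis. -/
theorem hsInner_eq_sum {ι : Type*} [Fintype ι] (b : OrthonormalBasis ι ℝ V) (A B : V →ₗ[ℝ] W) :
    hsInner A B = ∑ j, inner ℝ (A (b j)) (B (b j)) := by
  have hA : ∀ (C : V →ₗ[ℝ] W) (e : V), C e = ∑ j, inner ℝ (b j) e • C (b j) := fun C e => by
    conv_lhs => rw [← b.sum_repr' e]
    simp only [map_sum, map_smul]
  have hB : ∀ (C : V →ₗ[ℝ] W) (e : V), C e = ∑ i, inner ℝ (stdOrthonormalBasis ℝ V i) e •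
      C (stdOrthonormalBasis ℝ V i) := fun C e => by
    conv_lhs => rw [← (stdOrthonormalBasis ℝ V).sum_repr' e]
    simp only [map_sum, map_smul]
  have h1 : hsInner A B = ∑ i, ∑ j, inner ℝ (b j) (stdOrthonormalBasis ℝ V i) *
      inner ℝ (A (b j)) (B (stdOrthonormalBasis ℝ V i)) := by
    refine Finset.sum_congr rfl fun i _ => ?_
    rw [hA A, sum_inner]
    simp only [inner_smul_left, conj_trivial]
  have h2 : ∑ j, inner ℝ (A (b j)) (B (b j)) = ∑ j, ∑ i, inner ℝ (b j) (stdOrthonormalBasis ℝ V i) *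
      inner ℝ (A (b j)) (B (stdOrthonormalBasis ℝ V i)) := by
    refine Finset.sum_congr rfl fun j _ => ?_
    rw [hB B (b j), inner_sum]
    simp only [inner_smul_right, real_inner_comm]
  rw [h1, h2, Finset.sum_comm]

end HilbertSchmidt

instance finiteDimensionalTangentSpace {E : Type*} [NormedAddCommGroup E] [NormedSpace ℝ E]
    [h : FiniteDimensional ℝ E] {H : Type*} [TopologicalSpace H] (I : ModelWithCorners ℝ E H)
    {M : Type*} [TopologicalSpace M] [ChartedSpace H M] (x : M) :
    FiniteDimensional ℝ (TangentSpace I x) := h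

/-! ### The metric in a chart and the Riemannian volume -/

section Volume

variable {d : ℕ} {H : Type*} [TopologicalSpace H]
  (I : ModelWithCorners ℝ (EuclideanSpace ℝ (Fin d)) H)
  {M : Type*} [TopologicalSpace M] [ChartedSpace H M]

/-- The coordinate vector field `∂/∂zᵢ` of the chart around `x`, at the point of coordinates `z`. -/
def coordVector (x : M) (z : EuclideanSpace ℝ (Fin d)) (i : Fin d) :
    TangentSpace I ((extChartAt I x).symm z) :=
  mfderivWithin 𝓘(ℝ, EuclideanSpace ℝ (Fin d)) I (extChartAt I x).symm (range I) z
    (EuclideanSpace.single i (1 : ℝ))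

variable [IsManifold I ∞ M] [RiemannianBundle (fun x : M => TangentSpace I x)]

/-- The matrix `gᵢⱼ = ⟪∂/∂zᵢ, ∂/∂zⱼ⟫` of the metric in the chart around `x`, at the point of
coordinates `z`. -/
def gramMatrix (x : M) (z : EuclideanSpace ℝ (Fin d)) : Matrix (Fin d) (Fin d) ℝ :=
  Matrix.of fun i j => inner ℝ (coordVector I x z i) (coordVector I x z j)

variable [MeasurableSpace M]

/-- The measure `√(det gᵢⱼ) dz` in the chart around `x`, seen as a measure on `M` (concentrated on
the domain of the chart). -/
def chartVolume (x : M) : Measure M :=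
  ((volume.restrict (extChartAt I x).target).withDensity
    fun z => ENNReal.ofReal √((gramMatrix I x z).det)).map (extChartAt I x).symm

variable (M) [T2Space M] [SigmaCompactSpace M]

/-- A smooth partition of unity subordinate to the atlas of the preferred charts. -/
def chartPartition : SmoothPartitionOfUnity M I M univ :=
  (SmoothPartitionOfUnity.exists_isSubordinate_chartAt_source I M).choose

/-- The Riemannian volume measure `dV`: the chart measures `√(det gᵢⱼ) dz`, glued by a partition of
unity. By the change of variables formula it does not depend on the partition. -/
def riemannianVolume : Measure M :=
  Measure.sum fun x : M =>
    (chartVolume I x).withDensity fun y => ENNReal.ofReal (chartPartition I M x y)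

end Volume

/-! ### The Levi-Civita connection in charts: Hessian and derivative of vector fields along maps -/

section LeviCivita

variable {n : ℕ} {N : Type*} [TopologicalSpace N] [ChartedSpace (EuclideanSpace ℝ (Fin n)) N]
  [IsManifold (𝓡 n) ∞ N] [RiemannianBundle (fun y : N => TangentSpace (𝓡 n) y)]

/-- The partial derivative `∂ₗ gᵢⱼ` of the metric in the chart around `y`. -/
def gramDeriv (y : N) (z : EuclideanSpace ℝ (Fin n)) (l i j : Fin n) : ℝ :=
  fderiv ℝ (fun z' => gramMatrix (𝓡 n) y z' i j) z (EuclideanSpace.single l (1 : ℝ))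

/-- The Christoffel symbols `Γᵏᵢⱼ = ½ gᵏˡ (∂ᵢ gⱼₗ + ∂ⱼ gᵢₗ - ∂ₗ gᵢⱼ)` of the Levi-Civita connection
in the chart around `y`, at the point of coordinates `z`. -/
def christoffel (y : N) (z : EuclideanSpace ℝ (Fin n)) (k i j : Fin n) : ℝ :=
  1 / 2 * ∑ l, (gramMatrix (𝓡 n) y z)⁻¹ k l *
    (gramDeriv y z i j l + gramDeriv y z j i l - gramDeriv y z l i j)

/-- The representative of `f` in the chart around `y`. -/
def chartRep (f : N → ℝ) (y : N) : EuclideanSpace ℝ (Fin n) → ℝ :=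
  fun z => f ((extChartAt (𝓡 n) y).symm z)

/-- The map sending a tangent vector at `y'` to its coordinates in the chart around `y`. -/
def tangentCoord (y y' : N) : TangentSpace (𝓡 n) y' →L[ℝ] EuclideanSpace ℝ (Fin n) :=
  mfderiv (𝓡 n) 𝓘(ℝ, EuclideanSpace ℝ (Fin n)) (extChartAt (𝓡 n) y) y'

/-- The map sending `a` to the tangent vector `∑ aᵏ ∂/∂zₖ`, for the chart around `y`, at `y`. -/
def tangentOfCoord (y : N) : EuclideanSpace ℝ (Fin n) →L[ℝ] TangentSpace (𝓡 n) y :=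
  mfderivWithin 𝓘(ℝ, EuclideanSpace ℝ (Fin n)) (𝓡 n) (extChartAt (𝓡 n) y).symm (range (𝓡 n))
    (extChartAt (𝓡 n) y y)

/-- The Hessian `Hess f (v, w) = vⁱ wʲ (∂ᵢ ∂ⱼ f - Γᵏᵢⱼ ∂ₖ f)` at `y`. -/
def hessian (f : N → ℝ) (y : N) (v w : TangentSpace (𝓡 n) y) : ℝ :=
  let z := extChartAt (𝓡 n) y y
  ∑ i, ∑ j, tangentCoord y y v i * tangentCoord y y w j *
    (fderiv ℝ (fun z' => fderiv ℝ (chartRep f y) z' (EuclideanSpace.single j (1 : ℝ))) z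
        (EuclideanSpace.single i (1 : ℝ))
      - ∑ k, christoffel y z k i j *
          fderiv ℝ (chartRep f y) z (EuclideanSpace.single k (1 : ℝ)))

/-- A smooth function is convex if its Hessian is everywhere positive semidefinite. -/
def IsSmoothConvex (f : N → ℝ) : Prop :=
  ContMDiff (𝓡 n) 𝓘(ℝ) ∞ f ∧ ∀ (y : N) (v : TangentSpace (𝓡 n) y), 0 ≤ hessian f y v v

variable {d : ℕ} {H : Type*} [TopologicalSpace H]
  (I : ModelWithCorners ℝ (EuclideanSpace ℝ (Fin d)) H)
  {M : Type*} [TopologicalSpace M] [ChartedSpace H M]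

/-- The covariant differential `dX`, at `x`, of a vector field `X` along `u : M → N`, with respect
to the pull-back of the Levi-Civita connection of `N`. In the chart of `N` around `u x`,
`(dX (v))ᵏ = d(Xᵏ)(v) + Γᵏᵢⱼ duⁱ(v) Xʲ`. -/
def covDifferential (u : M → N) (X : ∀ x : M, TangentSpace (𝓡 n) (u x)) (x : M) :
    TangentSpace I x →ₗ[ℝ] TangentSpace (𝓡 n) (u x) :=
  let z := extChartAt (𝓡 n) (u x) (u x)
  let Xc : M → EuclideanSpace ℝ (Fin n) := fun x' => tangentCoord (u x) (u x') (X x')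
  let dXc : TangentSpace I x →L[ℝ] EuclideanSpace ℝ (Fin n) :=
    mfderiv I 𝓘(ℝ, EuclideanSpace ℝ (Fin n)) Xc x
  let duc : TangentSpace I x →L[ℝ] EuclideanSpace ℝ (Fin n) :=
    (tangentCoord (u x) (u x)).comp (mfderiv I (𝓡 n) u x)
  (tangentOfCoord (u x)).toLinearMap ∘ₗ
    (dXc.toLinearMap + (Matrix.toEuclideanLin (𝕜 := ℝ)
      (Matrix.of fun k i => ∑ j, christoffel (u x) z k i j * Xc x j)) ∘ₗ duc.toLinearMap)

end LeviCivita

/-! ### `p`-harmonic maps -/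

section PHarmonic

variable {d : ℕ} {H : Type*} [TopologicalSpace H]
  (I : ModelWithCorners ℝ (EuclideanSpace ℝ (Fin d)) H)
  {M : Type*} [TopologicalSpace M] [ChartedSpace H M] [IsManifold I ∞ M]
  [RiemannianBundle (fun x : M => TangentSpace I x)]
  [MeasurableSpace M] [T2Space M] [SigmaCompactSpace M]
  {n : ℕ} {N : Type*} [TopologicalSpace N] [ChartedSpace (EuclideanSpace ℝ (Fin n)) N]
  [IsManifold (𝓡 n) ∞ N] [RiemannianBundle (fun y : N => TangentSpace (𝓡 n) y)]

/-- The Hilbert–Schmidt product `⟪A, B⟫` of linear maps `A, B : T_x M → T_y N`. -/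
def hsTangent (x : M) (y : N) (A B : TangentSpace I x →ₗ[ℝ] TangentSpace (𝓡 n) y) : ℝ :=
  hsInner (V := TangentSpace I x) (W := TangentSpace (𝓡 n) y) A B

/-- The Hilbert–Schmidt norm `|du|` at `x`. -/
def normDifferential (u : M → N) (x : M) : ℝ :=
  √(hsTangent I x (u x) (mfderiv I (𝓡 n) u x).toLinearMap (mfderiv I (𝓡 n) u x).toLinearMap)

/-- A `C¹` map `u` is `p`-harmonic if `∫ ⟪|du|ᵖ⁻² du, dX⟫ dV = 0` (Hilbert–Schmidt norm and product)
for all `C¹` vector fields `X` along `u` with compact support in the interior of `M`. -/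
def IsPHarmonic (p : ℝ) (u : M → N) : Prop :=
  ContMDiff I (𝓡 n) 1 u ∧
  ∀ X : ∀ x : M, TangentSpace (𝓡 n) (u x),
    ContMDiff I (𝓡 n).tangent 1 (fun x => (⟨u x, X x⟩ : TangentBundle (𝓡 n) N)) →
    IsCompact (closure {x | X x ≠ 0}) →
    closure {x | X x ≠ 0} ⊆ I.interior M →
    ∫ x, normDifferential (n := n) I u x ^ (p - 2) *
      hsTangent (n := n) I x (u x) (mfderiv I (𝓡 n) u x).toLinearMap (covDifferential I u X x)
      ∂(riemannianVolume I M) = 0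

end PHarmonic

end

/-!
Let `c` be larger than the values of `w = f ∘ u` on the boundary, and let `φ` be a smooth monotone
nonnegative function vanishing exactly on `(-∞, c]`. The field `X = φ(w) ∇f(u)` along `u` is `C¹`,
and its support is contained in `{w ≥ c}`, which is compact and disjoint from the boundary. Since
`⟪du, dX⟫ = φ'(w) |dw|² + φ(w) tr Hess f (du, du)` is a sum of nonnegative terms
(`inner_mfderiv_covDifferential`), the weak equation tested on `X` says that a nonnegative function
has zero integral. This function is continuous, and the volume is finite and positive on nonempty
open sets, so it vanishes identically: at every point `du = 0` or `φ'(w) dw = 0`. In both cases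
`d(φ(w)) = 0`, so that `φ(w)` is locally constant. Every connected component meets the boundary,
where `φ(w) = 0`, hence `w ≤ c` on `M` (`IsPHarmonic.comp_le_of_boundary_lt`). No regularity
theory is involved.

The vanishing of the integral carries no information unless the integrand is integrable, and for
this the integrand is shown to be continuous (`continuous_integrand`). Two points need care. The
Hessian at `y` is defined in the preferred chart at `y`, which depends on `y` without any
regularity; its quadratic form is therefore rewritten as `½ (L_∇f g)(v, v)`, without Christoffel
symbols (`hessian_self_eq_chartHess`), and this expression is independent of the chart
(`chartHess_coordChange`). The Hilbert–Schmidt product is defined by an orthonormal basis of each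
tangent space, chosen independently at each point; it is rewritten as a trace with respect to the
inverse of the Gram matrix of a coordinate frame (`hsInner_eq_sum_gram_inv`).
-/

noncomputable section

/-! ### Hilbert–Schmidt product in an arbitrary basis -/

section LinearAlgebra

variable {V W : Type*} [NormedAddCommGroup V] [InnerProductSpace ℝ V] [FiniteDimensional ℝ V]
  [NormedAddCommGroup W] [InnerProductSpace ℝ W]

/-- The Hilbert–Schmidt product as a trace with respect to the inverse of the Gram matrix of an
arbitrary basis. -/
theorem hsInner_eq_sum_gram_inv {ι : Type*} [Fintype ι] [DecidableEq ι] (b : Module.Basis ι ℝ V)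
    (A B : V →ₗ[ℝ] W) :
    hsInner A B = ∑ i, ∑ j, (Matrix.gram ℝ b)⁻¹ i j * inner ℝ (A (b i)) (B (b j)) := by
  let e : OrthonormalBasis ι ℝ V := (stdOrthonormalBasis ℝ V).reindex
    (Fintype.equivOfCardEq (by
      rw [Fintype.card_fin, Module.finrank_eq_card_basis b]))
  let P : Matrix ι ι ℝ := Matrix.of fun k i => inner ℝ (e k) (b i)
  let Q : Matrix ι ι ℝ := Matrix.of fun k l => inner ℝ (A (e k)) (B (e l))
  have hP : Matrix.gram ℝ b = P.transpose * P := by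
    ext i j
    simp only [Matrix.gram_apply, Matrix.mul_apply, Matrix.transpose_apply, P, Matrix.of_apply]
    rw [← e.sum_inner_mul_inner]
    simp only [real_inner_comm]
  have hdet : P.det ≠ 0 := by
    have h := (Matrix.det_gram_ne_zero_iff_linearIndependent (𝕜 := ℝ) (v := b)).2
      b.linearIndependent
    rw [hP, Matrix.det_mul] at h
    exact right_ne_zero_of_mul h
  have hexp : ∀ i, b i = ∑ k, P k i • e k := fun i => (e.sum_repr' (b i)).symm
  have hQ : (Matrix.of fun i j => inner ℝ (A (b i)) (B (b j))) = P.transpose * Q * P := by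
    ext i j
    simp only [Matrix.of_apply, Matrix.mul_apply, Matrix.transpose_apply]
    rw [hexp i, hexp j]
    simp only [map_sum, map_smul, sum_inner, inner_sum, real_inner_smul_left,
      real_inner_smul_right, Q, Matrix.of_apply]
    refine Finset.sum_congr rfl fun l _ => ?_
    rw [Finset.sum_mul]
    exact Finset.sum_congr rfl fun k _ => by ring
  have hsymm : ((Matrix.gram ℝ b)⁻¹).transpose = (Matrix.gram ℝ b)⁻¹ := by
    rw [Matrix.transpose_nonsing_inv, hP, Matrix.transpose_mul, Matrix.transpose_transpose]
  have htr : ∑ i, ∑ j, (Matrix.gram ℝ b)⁻¹ i j * inner ℝ (A (b i)) (B (b j)) =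
      Matrix.trace ((Matrix.gram ℝ b)⁻¹ * (P.transpose * Q * P)) := by
    rw [← hQ]
    simp only [Matrix.trace, Matrix.diag_apply, Matrix.mul_apply, Matrix.of_apply]
    rw [Finset.sum_comm]
    refine Finset.sum_congr rfl fun i _ => Finset.sum_congr rfl fun j _ => ?_
    rw [← congrFun (congrFun hsymm j) i, Matrix.transpose_apply]
  have hu : IsUnit P.det := isUnit_iff_ne_zero.2 hdet
  rw [htr, hP, Matrix.mul_inv_rev, Matrix.mul_assoc, Matrix.mul_assoc P.transpose,
    Matrix.nonsing_inv_mul_cancel_left _ _ (by rwa [Matrix.det_transpose]), ← Matrix.mul_assoc,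
    Matrix.trace_mul_comm, Matrix.mul_nonsing_inv_cancel_left _ _ hu, hsInner_eq_sum e]
  rfl

theorem hsInner_self_nonneg (A : V →ₗ[ℝ] W) : 0 ≤ hsInner A A :=
  Finset.sum_nonneg fun _ _ => real_inner_self_nonneg

theorem hsInner_self_eq_zero {A : V →ₗ[ℝ] W} (h : hsInner A A = 0) : A = 0 := by
  have h' := (Finset.sum_eq_zero_iff_of_nonneg fun _ _ => real_inner_self_nonneg).1 h
  refine (stdOrthonormalBasis ℝ V).toBasis.ext fun i => ?_
  simpa using h' i (Finset.mem_univ i)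

end LinearAlgebra

/-! ### Coordinate frames and the matrix of the metric -/

section Frame

theorem gramMatrix_symm {d : ℕ} {H : Type*} [TopologicalSpace H]
    {I : ModelWithCorners ℝ (EuclideanSpace ℝ (Fin d)) H}
    {M : Type*} [TopologicalSpace M] [ChartedSpace H M]
    [RiemannianBundle (fun x : M => TangentSpace I x)] (x₀ : M) (z : EuclideanSpace ℝ (Fin d))
    (i j : Fin d) : gramMatrix I x₀ z i j = gramMatrix I x₀ z j i := by
  simp only [gramMatrix, Matrix.of_apply]
  exact real_inner_comm _ _

variable {d : ℕ} {H : Type*} [TopologicalSpace H]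
  (I : ModelWithCorners ℝ (EuclideanSpace ℝ (Fin d)) H)
  {M : Type*} [TopologicalSpace M] [ChartedSpace H M] [IsManifold I ∞ M]

/-- The coordinate vector fields of the chart around `x₀`, as a local frame of the tangent bundle;
they vanish outside of the domain of the chart. -/
def coordFrame (x₀ : M) (i : Fin d) (x : M) : TangentSpace I x :=
  (trivializationAt (EuclideanSpace ℝ (Fin d)) (TangentSpace I) x₀).localFrame
    (EuclideanSpace.basisFun (Fin d) ℝ).toBasis i x

variable {I}

theorem contMDiffAt_coordFrame {x₀ x : M} (hx : x ∈ (chartAt H x₀).source) (i : Fin d) :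
    ContMDiffAt I I.tangent ∞
      (fun x => (⟨x, coordFrame I x₀ i x⟩ : TangentBundle I M)) x :=
  contMDiffAt_localFrame_of_mem (n := ∞) _ _ i (by simpa using hx)

/-- The basis of the tangent space at `x` given by the coordinate vectors of the chart around
`x₀`. -/
def coordBasis {x₀ x : M} (hx : x ∈ (chartAt H x₀).source) :
    Module.Basis (Fin d) ℝ (TangentSpace I x) :=
  (trivializationAt (EuclideanSpace ℝ (Fin d)) (TangentSpace I) x₀).basisAt
    (EuclideanSpace.basisFun (Fin d) ℝ).toBasis (by simpa using hx)

theorem coordBasis_apply {x₀ x : M} (hx : x ∈ (chartAt H x₀).source) (i : Fin d) :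
    coordBasis (I := I) hx i = coordFrame I x₀ i x := by
  have hx' : x ∈ (trivializationAt (EuclideanSpace ℝ (Fin d)) (TangentSpace I) x₀).baseSet := by
    simpa using hx
  exact (Trivialization.localFrame_apply_of_mem_baseSet _ _ hx').symm

theorem symmL_single {x₀ x : M} (hx : x ∈ (chartAt H x₀).source) (i : Fin d) :
    (trivializationAt (EuclideanSpace ℝ (Fin d)) (TangentSpace I) x₀).symmL ℝ x
      (EuclideanSpace.single i (1 : ℝ)) = coordFrame I x₀ i x := by
  rw [← coordBasis_apply hx, coordBasis, Trivialization.basisAt, Module.Basis.map_apply]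
  simp only [OrthonormalBasis.coe_toBasis, EuclideanSpace.basisFun_apply]
  exact Trivialization.symmL_apply _ (by simpa using hx) _

theorem coordVector_eq_coordFrame {x₀ : M} {z : EuclideanSpace ℝ (Fin d)}
    (hz : z ∈ (extChartAt I x₀).target) (i : Fin d) :
    coordVector I x₀ z i = coordFrame I x₀ i ((extChartAt I x₀).symm z) := by
  have hx : (extChartAt I x₀).symm z ∈ (chartAt H x₀).source := by
    simpa using (extChartAt I x₀).map_target hz
  have h := TangentBundle.symmL_trivializationAt (I := I) hx
  rw [(extChartAt I x₀).right_inv hz] at h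
  rw [← symmL_single hx, h]
  rfl

variable [RiemannianBundle (fun x : M => TangentSpace I x)]

/-- In the domain of a chart, the matrix of the metric is the Gram matrix of the coordinate
basis. -/
theorem gramMatrix_extChartAt {x₀ x : M} (hx : x ∈ (chartAt H x₀).source) :
    gramMatrix I x₀ (extChartAt I x₀ x) = Matrix.gram ℝ (coordBasis (I := I) hx) := by
  have hx' : x ∈ (extChartAt I x₀).source := by simpa using hx
  ext i j
  simp only [gramMatrix, Matrix.of_apply, Matrix.gram_apply, coordBasis_apply,
    coordVector_eq_coordFrame ((extChartAt I x₀).map_source hx')]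
  exact congrArg (fun x => (inner ℝ (coordFrame I x₀ i x) (coordFrame I x₀ j x) : ℝ))
    ((extChartAt I x₀).left_inv hx')

theorem gramMatrix_det_pos {x₀ : M} {z : EuclideanSpace ℝ (Fin d)}
    (hz : z ∈ (extChartAt I x₀).target) : 0 < (gramMatrix I x₀ z).det := by
  have hx : (extChartAt I x₀).symm z ∈ (chartAt H x₀).source := by
    simpa using (extChartAt I x₀).map_target hz
  have h := congrArg Matrix.det (gramMatrix_extChartAt (I := I) hx)
  rw [(extChartAt I x₀).right_inv hz] at h
  have hb := (coordBasis (I := I) hx).linearIndependent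
  have hp : 0 < (Matrix.gram ℝ (coordBasis (I := I) hx)).det :=
    (Matrix.posDef_gram_of_linearIndependent hb).det_pos
  exact h ▸ hp

variable [IsContMDiffRiemannianBundle I ∞ (EuclideanSpace ℝ (Fin d))
      (fun x : M => TangentSpace I x)]

theorem contMDiffAt_inner_coordFrame {x₀ x : M} (hx : x ∈ (chartAt H x₀).source) (i j : Fin d) :
    ContMDiffAt I 𝓘(ℝ) ∞
      (fun x => (inner ℝ (coordFrame I x₀ i x) (coordFrame I x₀ j x) : ℝ)) x :=
  ContMDiffAt.inner_bundle (E := fun x : M => TangentSpace I x) (IB := I)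
    (b := fun x => x) (contMDiffAt_coordFrame hx i) (contMDiffAt_coordFrame hx j)

theorem contDiffOn_gramMatrix (x₀ : M) (i j : Fin d) :
    ContDiffOn ℝ ∞ (fun z => gramMatrix I x₀ z i j) (extChartAt I x₀).target := by
  rw [← contMDiffOn_iff_contDiffOn]
  intro z hz
  have hx : (extChartAt I x₀).symm z ∈ (chartAt H x₀).source := by
    simpa using (extChartAt I x₀).map_target hz
  have h := (contMDiffAt_inner_coordFrame (I := I) hx i j).comp_contMDiffWithinAt z
    (contMDiffOn_extChartAt_symm (n := ∞) x₀ z hz)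
  refine h.congr (fun z' hz' => ?_) ?_ <;>
  simp only [gramMatrix, Matrix.of_apply, Function.comp_apply, coordVector_eq_coordFrame, *]

end Frame

/-! ### Finiteness and positivity of the Riemannian volume -/

section VolumeProperties

variable {d : ℕ} {H : Type*} [TopologicalSpace H]
  {I : ModelWithCorners ℝ (EuclideanSpace ℝ (Fin d)) H}
  {M : Type*} [TopologicalSpace M] [ChartedSpace H M]

theorem measurableSet_extChartAt_target (x : M) : MeasurableSet (extChartAt I x).target := by
  rw [extChartAt_target]
  exact ((chartAt H x).open_target.preimage I.continuous_symm).measurableSet.inter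
    I.isClosed_range.measurableSet

variable [IsManifold I ∞ M] [RiemannianBundle (fun x : M => TangentSpace I x)]
  [IsContMDiffRiemannianBundle I ∞ (EuclideanSpace ℝ (Fin d)) (fun x : M => TangentSpace I x)]

theorem continuousOn_sqrt_det_gramMatrix (x : M) :
    ContinuousOn (fun z => √((gramMatrix I x z).det)) (extChartAt I x).target := by
  refine ContinuousOn.sqrt ?_
  simp only [Matrix.det_apply]
  exact continuousOn_finsetSum _ fun σ _ => ContinuousOn.const_smul
    (continuousOn_finsetProd _ fun i _ => (contDiffOn_gramMatrix x _ _).continuousOn) _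

variable [MeasurableSpace M] [BorelSpace M]

omit [IsManifold I ∞ M] [IsContMDiffRiemannianBundle I ∞ (EuclideanSpace ℝ (Fin d))
  (fun x : M => TangentSpace I x)] in
theorem chartVolume_apply (x : M) {s : Set M} (hs : MeasurableSet s) :
    chartVolume I x s = ∫⁻ z in (extChartAt I x).symm ⁻¹' s ∩ (extChartAt I x).target,
      ENNReal.ofReal √((gramMatrix I x z).det) := by
  have hm : AEMeasurable (extChartAt I x).symm
      ((volume.restrict (extChartAt I x).target).withDensity
        fun z => ENNReal.ofReal √((gramMatrix I x z).det)) :=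
    ((continuousOn_extChartAt_symm x).aemeasurable
      (measurableSet_extChartAt_target x)).mono_ac (withDensity_absolutelyContinuous _ _)
  rw [chartVolume, Measure.map_apply_of_aemeasurable hm hs, withDensity_apply',
    Measure.restrict_restrict' (measurableSet_extChartAt_target x)]

theorem chartVolume_lt_top_of_isCompact [T2Space M] {x : M} {K : Set M} (hK : IsCompact K)
    (hKs : K ⊆ (extChartAt I x).source) : chartVolume I x K < ⊤ := by
  rw [chartVolume_apply x hK.isClosed.measurableSet]
  have himage : (extChartAt I x).symm ⁻¹' K ∩ (extChartAt I x).target = extChartAt I x '' K := by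
    rw [(extChartAt I x).image_eq_target_inter_inv_preimage hKs, inter_comm]
  have hc : IsCompact (extChartAt I x '' K) :=
    hK.image_of_continuousOn ((continuousOn_extChartAt x).mono hKs)
  have hcont : ContinuousOn (fun z => √((gramMatrix I x z).det)) (extChartAt I x '' K) :=
    (continuousOn_sqrt_det_gramMatrix x).mono (himage ▸ inter_subset_right)
  rw [himage]
  exact (hcont.integrableOn_compact hc).lintegral_lt_top

theorem chartVolume_pos_of_isOpen {x y : M} {U : Set M} (hU : IsOpen U) (hy : y ∈ U)
    (hys : y ∈ (extChartAt I x).source) : chartVolume I x U ≠ 0 := by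
  rw [chartVolume_apply x hU.measurableSet]
  intro h0
  have hyt := (extChartAt I x).map_source hys
  have hnhds : (extChartAt I x).symm ⁻¹' U ∩ (extChartAt I x).target ∈
      𝓝[range I] (extChartAt I x y) := by
    have h1 := (continuousOn_extChartAt_symm (I := I) x) _ hyt
    rw [ContinuousWithinAt, (extChartAt I x).left_inv hys] at h1
    rw [← nhdsWithin_extChartAt_target_eq_of_mem hyt]
    exact Filter.inter_mem (h1 (hU.mem_nhds hy)) self_mem_nhdsWithin
  obtain ⟨O, hO, hyO, hOs⟩ := mem_nhdsWithin.1 hnhds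
  -- The range of the model is the closure of its interior, so that a boundary point is a limit of
  -- interior points.
  have hne : (O ∩ interior (range I)).Nonempty :=
    mem_closure_iff.1 (I.range_subset_closure_interior (extChartAt_target_subset_range x hyt)) O
      hO hyO
  have hsub : O ∩ interior (range I) ⊆
      (extChartAt I x).symm ⁻¹' U ∩ (extChartAt I x).target :=
    fun z hz => hOs ⟨hz.1, interior_subset hz.2⟩
  have hOm : IsOpen (O ∩ interior (range I)) := hO.inter isOpen_interior
  have h0' : ∫⁻ z in O ∩ interior (range I), ENNReal.ofReal √((gramMatrix I x z).det) = 0 :=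
    le_antisymm ((lintegral_mono_set hsub).trans h0.le) zero_le
  have hcont : ContinuousOn (fun z => √((gramMatrix I x z).det)) (O ∩ interior (range I)) :=
    (continuousOn_sqrt_det_gramMatrix x).mono fun z hz => (hsub hz).2
  rw [lintegral_eq_zero_iff' (hcont.aemeasurable hOm.measurableSet).ennreal_ofReal] at h0'
  have h1 := (ae_restrict_iff' hOm.measurableSet).1 h0'
  refine hOm.measure_pos volume hne |>.ne' (measure_mono_null (fun z hz => ?_) h1)
  simp only [mem_compl_iff, mem_ofPred_eq]
  intro hcon
  have := hcon hz
  simp only [Pi.zero_apply, ENNReal.ofReal_eq_zero] at this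
  exact absurd this (not_le.2 (Real.sqrt_pos.2 (gramMatrix_det_pos (hsub hz).2)))

variable [T2Space M]

theorem isOpenPosMeasure_riemannianVolume [SigmaCompactSpace M] :
    (riemannianVolume I M).IsOpenPosMeasure := by
  refine ⟨fun U hU ⟨y, hy⟩ h0 => ?_⟩
  obtain ⟨x, hx⟩ := (chartPartition I M).exists_pos_of_mem (mem_univ y)
  have hcont : Continuous (chartPartition I M x) := (chartPartition I M x).contMDiff.continuous
  rw [riemannianVolume, Measure.sum_apply _ hU.measurableSet, ENNReal.tsum_eq_zero] at h0
  have h1 := (withDensity_apply_eq_zero hcont.measurable.ennreal_ofReal).1 (h0 x)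
  have hV : IsOpen ({z | ENNReal.ofReal (chartPartition I M x z) ≠ 0} ∩ U) := by
    simp only [ne_eq, ENNReal.ofReal_eq_zero, not_le]
    exact (isOpen_lt continuous_const hcont).inter hU
  refine chartVolume_pos_of_isOpen hV ⟨?_, hy⟩ ?_ h1
  · simpa using hx
  · have hs := (SmoothPartitionOfUnity.exists_isSubordinate_chartAt_source I M).choose_spec x
    rw [extChartAt_source]
    exact hs (subset_tsupport _ hx.ne')

theorem isFiniteMeasure_riemannianVolume [CompactSpace M] :
    IsFiniteMeasure (riemannianVolume I M) := by
  refine ⟨?_⟩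
  rw [riemannianVolume, Measure.sum_apply _ MeasurableSet.univ]
  have hterm : ∀ x : M, (chartVolume I x).withDensity
      (fun y => ENNReal.ofReal (chartPartition I M x y)) univ ≤
        chartVolume I x (tsupport (chartPartition I M x)) := fun x => by
    rw [withDensity_apply _ MeasurableSet.univ, Measure.restrict_univ,
      ← lintegral_indicator_one (isClosed_tsupport _).measurableSet]
    refine lintegral_mono fun y => ?_
    by_cases hy : y ∈ tsupport (chartPartition I M x)
    · rw [indicator_of_mem hy]
      exact ENNReal.ofReal_le_one.2 ((chartPartition I M).le_one x y)
    · rw [indicator_of_notMem hy, image_eq_zero_of_notMem_tsupport hy, ENNReal.ofReal_zero]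
  have hfin : {x : M | (Function.support (chartPartition I M x)).Nonempty}.Finite :=
    (chartPartition I M).locallyFinite.finite_nonempty_of_compact
  rw [tsum_eq_sum (s := hfin.toFinset)]
  · refine ENNReal.sum_lt_top.2 fun x _ => (hterm x).trans_lt ?_
    refine chartVolume_lt_top_of_isCompact (isClosed_tsupport _).isCompact ?_
    rw [extChartAt_source]
    exact (SmoothPartitionOfUnity.exists_isSubordinate_chartAt_source I M).choose_spec x
  · intro x hx
    have h0 : ∀ y, chartPartition I M x y = 0 := by
      simpa [Set.not_nonempty_iff_eq_empty, Function.support_eq_empty_iff, funext_iff] using hx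
    simp [h0]

end VolumeProperties

/-! ### Coordinate changes and the metric as a bilinear form -/

section CoordinateCalculus

set_option synthInstance.maxHeartbeats 200000 in
/-- Under a coordinate change `τ`, if the bilinear forms `G₀`, `G₁` and the vector fields `a₀`, `a₁`
correspond, then so do the quadratic forms `½ L_a G`, written in coordinates as
`c ↦ ½ DG[a](c, c) + G(Da[c], c)`. The terms with `D²τ` cancel by symmetry. -/
theorem half_lieDeriv_coordChange {E F : Type*} [NormedAddCommGroup E] [NormedSpace ℝ E]
    [NormedAddCommGroup F] [NormedSpace ℝ F] {G₀ : E → E →L[ℝ] E →L[ℝ] ℝ}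
    {G₁ : F → F →L[ℝ] F →L[ℝ] ℝ} {a₀ : E → E} {a₁ : F → F} {τ : E → F} {z : E}
    (hτ : ContDiffAt ℝ 2 τ z) (hG₀d : DifferentiableAt ℝ G₀ z)
    (hG₁d : DifferentiableAt ℝ G₁ (τ z)) (ha₀d : DifferentiableAt ℝ a₀ z)
    (ha₁d : DifferentiableAt ℝ a₁ (τ z))
    (hG : ∀ᶠ z' in 𝓝 z, ∀ v w, G₀ z' v w = G₁ (τ z') (fderiv ℝ τ z' v) (fderiv ℝ τ z' w))
    (ha : ∀ᶠ z' in 𝓝 z, a₁ (τ z') = fderiv ℝ τ z' (a₀ z'))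
    (hsymm : ∀ v w, G₁ (τ z) v w = G₁ (τ z) w v) (c : E) :
    1 / 2 * fderiv ℝ G₀ z (a₀ z) c c + G₀ z (fderiv ℝ a₀ z c) c =
      1 / 2 * fderiv ℝ G₁ (τ z) (a₁ (τ z)) (fderiv ℝ τ z c) (fderiv ℝ τ z c) +
        G₁ (τ z) (fderiv ℝ a₁ (τ z) (fderiv ℝ τ z c)) (fderiv ℝ τ z c) := by
  have hτ1 : HasFDerivAt τ (fderiv ℝ τ z) z := (hτ.differentiableAt (by norm_num)).hasFDerivAt
  have hτ2 : HasFDerivAt (fderiv ℝ τ) (fderiv ℝ (fderiv ℝ τ) z) z :=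
    ((hτ.fderiv_right (m := 1) (by norm_num)).differentiableAt (by norm_num)).hasFDerivAt
  have hτs : ∀ v w, fderiv ℝ (fderiv ℝ τ) z v w = fderiv ℝ (fderiv ℝ τ) z w v :=
    (hτ.isSymmSndFDerivAt (by simp)).eq
  have hτc : HasFDerivAt (fun z' => fderiv ℝ τ z' c)
      ((ContinuousLinearMap.apply ℝ F c).comp (fderiv ℝ (fderiv ℝ τ) z)) z :=
    (ContinuousLinearMap.apply ℝ F c).hasFDerivAt.comp z hτ2
  have h1 : fderiv ℝ G₀ z (a₀ z) c c =
      fderiv ℝ G₁ (τ z) (fderiv ℝ τ z (a₀ z)) (fderiv ℝ τ z c) (fderiv ℝ τ z c) +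
        2 * G₁ (τ z) (fderiv ℝ (fderiv ℝ τ) z (a₀ z) c) (fderiv ℝ τ z c) := by
    have hL := (hG₀d.hasFDerivAt.clm_apply (hasFDerivAt_const c z)).clm_apply
      (hasFDerivAt_const c z)
    have hG₁τ : HasFDerivAt (fun z' => G₁ (τ z')) ((fderiv ℝ G₁ (τ z)).comp (fderiv ℝ τ z)) z :=
      HasFDerivAt.comp (𝕜 := ℝ) (E := E) (F := F) (G := F →L[ℝ] F →L[ℝ] ℝ) (g := G₁) (f := τ)
        z hG₁d.hasFDerivAt hτ1
    have hR := (hG₁τ.clm_apply hτc).clm_apply hτc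
    have hLR := congrArg (fun T : E →L[ℝ] ℝ => T (a₀ z))
      (hL.unique (hR.congr_of_eventuallyEq (hG.mono fun z' h => h c c)))
    simp only [ContinuousLinearMap.comp_apply, ContinuousLinearMap.apply_apply,
      add_apply, ContinuousLinearMap.flip_apply,
      zero_apply, map_zero, zero_add] at hLR
    rw [hLR, hsymm (fderiv ℝ τ z c)]
    ring
  have h2 : fderiv ℝ a₁ (τ z) (fderiv ℝ τ z c) =
      fderiv ℝ (fderiv ℝ τ) z c (a₀ z) + fderiv ℝ τ z (fderiv ℝ a₀ z c) := by
    have hL := ha₁d.hasFDerivAt.comp z hτ1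
    have hR := hτ2.clm_apply ha₀d.hasFDerivAt
    have hLR := congrArg (fun T : E →L[ℝ] F => T c) (hL.unique (hR.congr_of_eventuallyEq ha))
    simp only [ContinuousLinearMap.comp_apply, add_apply,
      ContinuousLinearMap.flip_apply] at hLR
    rw [hLR, add_comm]
  rw [h1, h2, ha.self_of_nhds, hG.self_of_nhds, map_add, add_apply,
    hτs c (a₀ z)]
  ring

end CoordinateCalculus

section ChartMetric

theorem sum_smul_single {n : ℕ} (v : EuclideanSpace ℝ (Fin n)) :
    ∑ i, v i • EuclideanSpace.single i (1 : ℝ) = v := by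
  simpa using (EuclideanSpace.basisFun (Fin n) ℝ).sum_repr v

theorem bilin_eq_sum {n : ℕ}
    (B : EuclideanSpace ℝ (Fin n) →L[ℝ] EuclideanSpace ℝ (Fin n) →L[ℝ] ℝ)
    (v w : EuclideanSpace ℝ (Fin n)) :
    B v w = ∑ i, ∑ j, v i * w j * B (EuclideanSpace.single i 1) (EuclideanSpace.single j 1) := by
  conv_lhs => rw [← sum_smul_single v, ← sum_smul_single w]
  simp only [map_sum, map_smul, sum_apply, smul_apply,
    smul_eq_mul, Finset.mul_sum]
  rw [Finset.sum_comm]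
  exact Finset.sum_congr rfl fun i _ => Finset.sum_congr rfl fun j _ => by ring

variable {n : ℕ} {N : Type*} [TopologicalSpace N] [ChartedSpace (EuclideanSpace ℝ (Fin n)) N]

section

variable [IsManifold (𝓡 n) ∞ N]

theorem tangentCoord_eq_continuousLinearMapAt {y₀ y : N}
    (hy : y ∈ (chartAt (EuclideanSpace ℝ (Fin n)) y₀).source) :
    tangentCoord y₀ y =
      (trivializationAt (EuclideanSpace ℝ (Fin n)) (TangentSpace (𝓡 n)) y₀).continuousLinearMapAt
        ℝ y :=
  (TangentBundle.continuousLinearMapAt_trivializationAt hy).symm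

theorem tangentCoord_symmL {y₀ y : N} (hy : y ∈ (chartAt (EuclideanSpace ℝ (Fin n)) y₀).source)
    (v : EuclideanSpace ℝ (Fin n)) :
    tangentCoord y₀ y ((trivializationAt (EuclideanSpace ℝ (Fin n)) (TangentSpace (𝓡 n)) y₀).symmL
      ℝ y v) = v := by
  rw [tangentCoord_eq_continuousLinearMapAt hy]
  exact Trivialization.continuousLinearMapAt_symmL _ (by simpa using hy) v

theorem symmL_tangentCoord {y₀ y : N} (hy : y ∈ (chartAt (EuclideanSpace ℝ (Fin n)) y₀).source)
    (v : TangentSpace (𝓡 n) y) :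
    (trivializationAt (EuclideanSpace ℝ (Fin n)) (TangentSpace (𝓡 n)) y₀).symmL ℝ y
      (tangentCoord y₀ y v) = v := by
  rw [tangentCoord_eq_continuousLinearMapAt hy]
  exact Trivialization.symmL_continuousLinearMapAt _ (by simpa using hy) v

theorem tangentCoord_tangentOfCoord (y : N) (b : EuclideanSpace ℝ (Fin n)) :
    tangentCoord y y (tangentOfCoord y b) = b := by
  have h := TangentBundle.symmL_trivializationAt (I := 𝓡 n)
    (mem_chart_source (EuclideanSpace ℝ (Fin n)) y)
  have h' := tangentCoord_symmL (mem_chart_source (EuclideanSpace ℝ (Fin n)) y) b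
  rw [h] at h'
  exact h'

end

variable [RiemannianBundle (fun y : N => TangentSpace (𝓡 n) y)]

/-- The metric in the chart around `y`, as a bilinear form on the model space depending on the
point of coordinates `z`. -/
def gramForm (y : N) (z : EuclideanSpace ℝ (Fin n)) :
    EuclideanSpace ℝ (Fin n) →L[ℝ] EuclideanSpace ℝ (Fin n) →L[ℝ] ℝ :=
  ∑ i, ∑ j, gramMatrix (𝓡 n) y z i j •
    (EuclideanSpace.proj i : EuclideanSpace ℝ (Fin n) →L[ℝ] ℝ).smulRight
      (EuclideanSpace.proj j : EuclideanSpace ℝ (Fin n) →L[ℝ] ℝ)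

theorem gramForm_apply (y : N) (z v w : EuclideanSpace ℝ (Fin n)) :
    gramForm y z v w = ∑ i, ∑ j, gramMatrix (𝓡 n) y z i j * (v i * w j) := by
  simp [gramForm]

theorem gramForm_symm (y : N) (z v w : EuclideanSpace ℝ (Fin n)) :
    gramForm y z v w = gramForm y z w v := by
  rw [gramForm_apply, gramForm_apply, Finset.sum_comm]
  refine Finset.sum_congr rfl fun i _ => Finset.sum_congr rfl fun j _ => ?_
  rw [gramMatrix_symm, mul_comm (v j)]

theorem gramForm_single (y : N) (z : EuclideanSpace ℝ (Fin n)) (i j : Fin n) :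
    gramForm y z (EuclideanSpace.single i 1) (EuclideanSpace.single j 1) =
      gramMatrix (𝓡 n) y z i j := by
  rw [gramForm_apply, Finset.sum_eq_single i, Finset.sum_eq_single j] <;> simp +contextual

variable [IsManifold (𝓡 n) ∞ N]

theorem gramForm_extChartAt_tangentCoord {y₀ y : N}
    (hy : y ∈ (chartAt (EuclideanSpace ℝ (Fin n)) y₀).source) (v w : TangentSpace (𝓡 n) y) :
    gramForm y₀ (extChartAt (𝓡 n) y₀ y) (tangentCoord y₀ y v) (tangentCoord y₀ y w) =
      inner ℝ v w := by
  have h : ∀ v : TangentSpace (𝓡 n) y,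
      v = ∑ i, tangentCoord y₀ y v i • coordBasis (I := 𝓡 n) hy i := fun v => by
    conv_lhs => rw [← symmL_tangentCoord hy v]
    conv_lhs => rw [← sum_smul_single (tangentCoord y₀ y v)]
    simp only [map_sum, map_smul, symmL_single hy, coordBasis_apply]
  rw [gramForm_apply, gramMatrix_extChartAt hy]
  conv_rhs => rw [h v, h w]
  simp only [sum_inner, inner_sum, real_inner_smul_left, real_inner_smul_right,
    Matrix.gram_apply]
  rw [Finset.sum_comm]
  exact Finset.sum_congr rfl fun i _ => Finset.sum_congr rfl fun j _ => by ring

end ChartMetric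

/-! ### Regularity of the metric and of the gradient in charts -/

section ChartGradient

theorem contDiff_smul_vector {F : Type*} [NormedAddCommGroup F] [NormedSpace ℝ F] (T : F) :
    ContDiff ℝ ∞ (fun c : ℝ => c • T) :=
  contDiff_id.smul contDiff_const

variable {n : ℕ} {N : Type*} [TopologicalSpace N] [ChartedSpace (EuclideanSpace ℝ (Fin n)) N]
  [IsManifold (𝓡 n) ∞ N] [RiemannianBundle (fun y : N => TangentSpace (𝓡 n) y)]

theorem isInvertible_gramForm {y : N} {z : EuclideanSpace ℝ (Fin n)}
    (hz : z ∈ (extChartAt (𝓡 n) y).target) : (gramForm y z).IsInvertible := by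
  have hx : (extChartAt (𝓡 n) y).symm z ∈ (chartAt (EuclideanSpace ℝ (Fin n)) y).source := by
    simpa using (extChartAt (𝓡 n) y).map_target hz
  have hinj : Function.Injective (gramForm y z) := by
    refine (injective_iff_map_eq_zero _).2 fun v hv => ?_
    have h := gramForm_extChartAt_tangentCoord hx
      ((trivializationAt (EuclideanSpace ℝ (Fin n)) (TangentSpace (𝓡 n)) y).symmL ℝ _ v)
      ((trivializationAt (EuclideanSpace ℝ (Fin n)) (TangentSpace (𝓡 n)) y).symmL ℝ _ v)
    rw [tangentCoord_symmL hx, (extChartAt (𝓡 n) y).right_inv hz, hv, zero_apply] at h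
    have h' := inner_self_eq_zero.1 h.symm
    rw [← tangentCoord_symmL hx v, h', map_zero]
  have hrank : Module.finrank ℝ (EuclideanSpace ℝ (Fin n)) =
      Module.finrank ℝ (EuclideanSpace ℝ (Fin n) →L[ℝ] ℝ) := by
    rw [← LinearMap.toContinuousLinearMap.finrank_eq]
    exact (Subspace.dual_finrank_eq).symm
  exact ⟨(LinearEquiv.ofInjectiveOfFinrankEq (gramForm y z).toLinearMap hinj
    hrank).toContinuousLinearEquiv, by ext; rfl⟩

/-- The gradient of `f` in the chart around `y`. -/
def chartGrad (f : N → ℝ) (y : N) (z : EuclideanSpace ℝ (Fin n)) : EuclideanSpace ℝ (Fin n) :=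
  (gramForm y z).inverse (fderiv ℝ (chartRep f y) z)

theorem gramForm_chartGrad (f : N → ℝ) {y : N} {z : EuclideanSpace ℝ (Fin n)}
    (hz : z ∈ (extChartAt (𝓡 n) y).target) :
    gramForm y z (chartGrad f y z) = fderiv ℝ (chartRep f y) z := by
  obtain ⟨e, he⟩ := isInvertible_gramForm hz
  rw [chartGrad, ← he, ContinuousLinearMap.inverse_equiv]
  exact e.apply_symm_apply _

omit [RiemannianBundle (fun y : N => TangentSpace (𝓡 n) y)] in
theorem contDiffOn_chartRep {f : N → ℝ} (hf : ContMDiff (𝓡 n) 𝓘(ℝ) ∞ f) (y : N) :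
    ContDiffOn ℝ ∞ (chartRep f y) (extChartAt (𝓡 n) y).target := by
  rw [← contMDiffOn_iff_contDiffOn]
  exact hf.comp_contMDiffOn (contMDiffOn_extChartAt_symm y)

variable [IsContMDiffRiemannianBundle (𝓡 n) ∞ (EuclideanSpace ℝ (Fin n))
      (fun y : N => TangentSpace (𝓡 n) y)]

theorem contDiffOn_gramForm (y : N) :
    ContDiffOn ℝ ∞ (gramForm y) (extChartAt (𝓡 n) y).target := by
  have key : ∀ T : EuclideanSpace ℝ (Fin n) →L[ℝ] EuclideanSpace ℝ (Fin n) →L[ℝ] ℝ,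
      ContDiff ℝ ∞ (fun c : ℝ => c • T) := fun T =>
    contDiff_smul_vector (F := EuclideanSpace ℝ (Fin n) →L[ℝ] EuclideanSpace ℝ (Fin n) →L[ℝ] ℝ) T
  refine ContDiffOn.sum fun i _ => ContDiffOn.sum fun j _ => ?_
  exact (key _).comp_contDiffOn (contDiffOn_gramMatrix y i j)

theorem contDiffOn_chartGrad {f : N → ℝ} (hf : ContMDiff (𝓡 n) 𝓘(ℝ) ∞ f) (y : N) :
    ContDiffOn ℝ ∞ (chartGrad f y) (extChartAt (𝓡 n) y).target := by
  intro z hz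
  have ho := isOpen_extChartAt_target (I := 𝓡 n) y
  obtain ⟨e, he⟩ := isInvertible_gramForm hz
  have h1 : ContDiffAt ℝ ∞ (fun z => (gramForm y z).inverse) z := by
    have h := contDiffAt_map_inverse (n := ∞) e
    rw [he] at h
    exact h.comp z ((contDiffOn_gramForm y).contDiffAt (ho.mem_nhds hz))
  have h2 : ContDiffAt ℝ ∞ (fderiv ℝ (chartRep f y)) z :=
    ((contDiffOn_chartRep hf y).contDiffAt (ho.mem_nhds hz)).fderiv_right (by simp)
  exact (h1.clm_apply h2).contDiffWithinAt

set_option synthInstance.maxHeartbeats 200000 in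
theorem fderiv_gramForm_single {y : N} {z : EuclideanSpace ℝ (Fin n)}
    (hz : z ∈ (extChartAt (𝓡 n) y).target) (l : EuclideanSpace ℝ (Fin n)) (i j : Fin n) :
    fderiv ℝ (gramForm y) z l (EuclideanSpace.single i 1) (EuclideanSpace.single j 1) =
      fderiv ℝ (fun z' => gramMatrix (𝓡 n) y z' i j) z l := by
  have hd : HasFDerivAt (gramForm y) (fderiv ℝ (gramForm y) z) z :=
    (((contDiffOn_gramForm y).contDiffAt
      ((isOpen_extChartAt_target y).mem_nhds hz)).differentiableAt (by simp)).hasFDerivAt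
  have h := (hd.clm_apply (hasFDerivAt_const (EuclideanSpace.single i (1 : ℝ)) z)).clm_apply
    (hasFDerivAt_const (EuclideanSpace.single j (1 : ℝ)) z)
  simp only [gramForm_single] at h
  rw [h.fderiv]
  simp

end ChartGradient

/-! ### The Riemannian gradient and the Christoffel symbols -/

section Gradient

variable {n : ℕ} {N : Type*} [TopologicalSpace N] [ChartedSpace (EuclideanSpace ℝ (Fin n)) N]
  [IsManifold (𝓡 n) ∞ N]

theorem fderiv_chartRep_tangentCoord {f : N → ℝ} (hf : ContMDiff (𝓡 n) 𝓘(ℝ) ∞ f) {y₀ y : N}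
    (hy : y ∈ (chartAt (EuclideanSpace ℝ (Fin n)) y₀).source) (v : TangentSpace (𝓡 n) y) :
    fderiv ℝ (chartRep f y₀) (extChartAt (𝓡 n) y₀ y) (tangentCoord y₀ y v) =
      mfderiv (𝓡 n) 𝓘(ℝ) f y v := by
  have hy' : y ∈ (extChartAt (𝓡 n) y₀).source := by simpa using hy
  have hd : DifferentiableAt ℝ (chartRep f y₀) (extChartAt (𝓡 n) y₀ y) :=
    ((contDiffOn_chartRep hf y₀).contDiffAt ((isOpen_extChartAt_target y₀).mem_nhds
      ((extChartAt (𝓡 n) y₀).map_source hy'))).differentiableAt (by simp)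
  have heq : f =ᶠ[𝓝 y] chartRep f y₀ ∘ extChartAt (𝓡 n) y₀ := by
    filter_upwards [(isOpen_extChartAt_source (I := 𝓡 n) y₀).mem_nhds hy'] with y' hy'
    simp only [chartRep, Function.comp_apply, (extChartAt (𝓡 n) y₀).left_inv hy']
  have h := (hd.hasFDerivAt.hasMFDerivAt.comp y
    (mdifferentiableAt_extChartAt (I := 𝓡 n) hy).hasMFDerivAt).congr_of_eventuallyEq heq
  rw [h.mfderiv]
  rfl

variable [RiemannianBundle (fun y : N => TangentSpace (𝓡 n) y)]

/-- The Riemannian gradient of `f`. -/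
def riemannianGrad (f : N → ℝ) (y : N) : TangentSpace (𝓡 n) y :=
  tangentOfCoord y (chartGrad f y (extChartAt (𝓡 n) y y))

theorem inner_riemannianGrad {f : N → ℝ} (hf : ContMDiff (𝓡 n) 𝓘(ℝ) ∞ f) (y : N)
    (v : TangentSpace (𝓡 n) y) :
    inner ℝ (riemannianGrad f y) v = mfderiv (𝓡 n) 𝓘(ℝ) f y v := by
  have hy := mem_chart_source (EuclideanSpace ℝ (Fin n)) y
  rw [← gramForm_extChartAt_tangentCoord hy, riemannianGrad, tangentCoord_tangentOfCoord,
    gramForm_chartGrad f (mem_extChartAt_target y), fderiv_chartRep_tangentCoord hf hy]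

/-- The coordinates of the gradient in an arbitrary chart. -/
theorem tangentCoord_riemannianGrad {f : N → ℝ} (hf : ContMDiff (𝓡 n) 𝓘(ℝ) ∞ f) {y₀ y : N}
    (hy : y ∈ (chartAt (EuclideanSpace ℝ (Fin n)) y₀).source) :
    tangentCoord y₀ y (riemannianGrad f y) = chartGrad f y₀ (extChartAt (𝓡 n) y₀ y) := by
  have hz : extChartAt (𝓡 n) y₀ y ∈ (extChartAt (𝓡 n) y₀).target :=
    (extChartAt (𝓡 n) y₀).map_source (by simpa using hy)
  refine (isInvertible_gramForm hz).injective ?_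
  rw [gramForm_chartGrad f hz]
  ext w
  rw [← tangentCoord_symmL hy w, gramForm_extChartAt_tangentCoord hy, inner_riemannianGrad hf,
    fderiv_chartRep_tangentCoord hf hy]

variable [IsContMDiffRiemannianBundle (𝓡 n) ∞ (EuclideanSpace ℝ (Fin n))
      (fun y : N => TangentSpace (𝓡 n) y)]

theorem contMDiff_riemannianGrad {f : N → ℝ} (hf : ContMDiff (𝓡 n) 𝓘(ℝ) ∞ f) :
    ContMDiff (𝓡 n) (𝓡 n).tangent ∞
      (fun y => (⟨y, riemannianGrad f y⟩ : TangentBundle (𝓡 n) N)) := by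
  intro y₀
  refine (contMDiffAt_section y₀).2 ?_
  have hs : (chartAt (EuclideanSpace ℝ (Fin n)) y₀).source ∈ 𝓝 y₀ := chart_source_mem_nhds _ y₀
  have h : ContMDiffAt (𝓡 n) 𝓘(ℝ, EuclideanSpace ℝ (Fin n)) ∞
      (fun y => chartGrad f y₀ (extChartAt (𝓡 n) y₀ y)) y₀ :=
    ((contDiffOn_chartGrad hf y₀).contDiffAt ((isOpen_extChartAt_target y₀).mem_nhds
      (mem_extChartAt_target y₀))).contMDiffAt.comp y₀ contMDiffAt_extChartAt
  refine h.congr_of_eventuallyEq ?_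
  filter_upwards [hs] with y hy
  rw [← tangentCoord_riemannianGrad hf hy, tangentCoord_eq_continuousLinearMapAt hy]
  exact (Trivialization.continuousLinearMapAt_apply_of_mem _ _ (by simpa using hy) _).symm

end Gradient

section Christoffel

variable {n : ℕ} {N : Type*} [TopologicalSpace N] [ChartedSpace (EuclideanSpace ℝ (Fin n)) N]
  [IsManifold (𝓡 n) ∞ N] [RiemannianBundle (fun y : N => TangentSpace (𝓡 n) y)]
  [IsContMDiffRiemannianBundle (𝓡 n) ∞ (EuclideanSpace ℝ (Fin n))
      (fun y : N => TangentSpace (𝓡 n) y)]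

set_option synthInstance.maxHeartbeats 200000 in
/-- The Christoffel symbols of the first kind: lowering the upper index of `Γᵏᵢⱼ` removes the
inverse of the metric. -/
theorem sum_christoffel_mul_gramForm {y : N} {z : EuclideanSpace ℝ (Fin n)}
    (hz : z ∈ (extChartAt (𝓡 n) y).target) (i j : Fin n) (a : EuclideanSpace ℝ (Fin n)) :
    ∑ k, christoffel y z k i j * gramForm y z (EuclideanSpace.single k 1) a =
      1 / 2 * (fderiv ℝ (gramForm y) z (EuclideanSpace.single i 1) (EuclideanSpace.single j 1) a +
        fderiv ℝ (gramForm y) z (EuclideanSpace.single j 1) (EuclideanSpace.single i 1) a -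
        fderiv ℝ (gramForm y) z a (EuclideanSpace.single i 1) (EuclideanSpace.single j 1)) := by
  have hG : ∀ k, gramForm y z (EuclideanSpace.single k 1) a =
      ∑ l, gramMatrix (𝓡 n) y z k l * a l := fun k => by
    conv_lhs => rw [← sum_smul_single a]
    simp only [map_sum, map_smul, smul_eq_mul, gramForm_single]
    exact Finset.sum_congr rfl fun l _ => mul_comm _ _
  have hinv : ∀ l q, ∑ k, (gramMatrix (𝓡 n) y z)⁻¹ k l * gramMatrix (𝓡 n) y z k q =
      (1 : Matrix (Fin n) (Fin n) ℝ) q l := fun l q => by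
    rw [← Matrix.mul_nonsing_inv (gramMatrix (𝓡 n) y z)
      (isUnit_iff_ne_zero.2 (gramMatrix_det_pos hz).ne'), Matrix.mul_apply]
    exact Finset.sum_congr rfl fun k _ => by rw [gramMatrix_symm y z k q, mul_comm]
  have hR : fderiv ℝ (gramForm y) z (EuclideanSpace.single i 1) (EuclideanSpace.single j 1) a +
        fderiv ℝ (gramForm y) z (EuclideanSpace.single j 1) (EuclideanSpace.single i 1) a -
        fderiv ℝ (gramForm y) z a (EuclideanSpace.single i 1) (EuclideanSpace.single j 1) =
      ∑ l, (gramDeriv y z i j l + gramDeriv y z j i l - gramDeriv y z l i j) * a l := by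
    conv_lhs => rw [← sum_smul_single a]
    simp only [map_sum, map_smul, sum_apply, smul_apply, smul_eq_mul, fderiv_gramForm_single hz,
      gramDeriv, ← Finset.sum_add_distrib, ← Finset.sum_sub_distrib]
    exact Finset.sum_congr rfl fun l _ => by ring
  rw [hR]
  simp only [hG, christoffel]
  set T : Fin n → ℝ := fun l => gramDeriv y z i j l + gramDeriv y z j i l - gramDeriv y z l i j
  calc ∑ k, 1 / 2 * (∑ l, (gramMatrix (𝓡 n) y z)⁻¹ k l * T l) *
        ∑ q, gramMatrix (𝓡 n) y z k q * a q
      = ∑ k, ∑ l, ∑ q, 1 / 2 * (T l * a q *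
          ((gramMatrix (𝓡 n) y z)⁻¹ k l * gramMatrix (𝓡 n) y z k q)) := by
        refine Finset.sum_congr rfl fun k _ => ?_
        rw [mul_assoc, Finset.sum_mul_sum, Finset.mul_sum]
        refine Finset.sum_congr rfl fun l _ => ?_
        rw [Finset.mul_sum]
        exact Finset.sum_congr rfl fun q _ => by ring
    _ = ∑ l, ∑ q, 1 / 2 * (T l * a q * (1 : Matrix (Fin n) (Fin n) ℝ) q l) := by
        rw [Finset.sum_comm]
        refine Finset.sum_congr rfl fun l _ => ?_
        rw [Finset.sum_comm]
        refine Finset.sum_congr rfl fun q _ => ?_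
        rw [← Finset.mul_sum, ← Finset.mul_sum, hinv]
    _ = 1 / 2 * ∑ l, T l * a l := by
        rw [Finset.mul_sum]
        refine Finset.sum_congr rfl fun l _ => ?_
        rw [Finset.sum_eq_single l] <;> simp +contextual

set_option synthInstance.maxHeartbeats 200000 in
theorem trilin_eq_sum (T : EuclideanSpace ℝ (Fin n) →L[ℝ] EuclideanSpace ℝ (Fin n) →L[ℝ]
    EuclideanSpace ℝ (Fin n) →L[ℝ] ℝ) (u v w : EuclideanSpace ℝ (Fin n)) :
    T u v w = ∑ i, ∑ j, u i * v j *
      T (EuclideanSpace.single i 1) (EuclideanSpace.single j 1) w := by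
  conv_lhs => rw [← sum_smul_single u, ← sum_smul_single v]
  simp only [map_sum, map_smul, sum_apply, smul_apply, smul_eq_mul, Finset.mul_sum]
  rw [Finset.sum_comm]
  exact Finset.sum_congr rfl fun i _ => Finset.sum_congr rfl fun j _ => by ring

theorem fderiv_gramForm_symm {y : N} {z : EuclideanSpace ℝ (Fin n)}
    (hz : z ∈ (extChartAt (𝓡 n) y).target) (l v w : EuclideanSpace ℝ (Fin n)) :
    fderiv ℝ (gramForm y) z l v w = fderiv ℝ (gramForm y) z l w v := by
  rw [bilin_eq_sum _ v w, bilin_eq_sum _ w v, Finset.sum_comm]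
  refine Finset.sum_congr rfl fun i _ => Finset.sum_congr rfl fun j _ => ?_
  rw [fderiv_gramForm_single hz, fderiv_gramForm_single hz, mul_comm (v j)]
  simp only [gramMatrix_symm y _ j i]

/-- The value at `(c, a)` of the Christoffel symbols of the first kind, paired with `c`. -/
theorem gramForm_christoffel {y : N} {z : EuclideanSpace ℝ (Fin n)}
    (hz : z ∈ (extChartAt (𝓡 n) y).target) (c a : EuclideanSpace ℝ (Fin n)) :
    gramForm y z c (Matrix.toEuclideanLin (𝕜 := ℝ)
      (Matrix.of fun k i => ∑ j, christoffel y z k i j * a j) c) =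
      1 / 2 * fderiv ℝ (gramForm y) z a c c := by
  have hΓ := sum_christoffel_mul_gramForm hz
  have h1 : ∀ w : EuclideanSpace ℝ (Fin n), gramForm y z c w =
      ∑ k, w k * gramForm y z (EuclideanSpace.single k 1) c := fun w => by
    rw [gramForm_symm]
    conv_lhs => rw [← sum_smul_single w]
    simp only [map_sum, map_smul, sum_apply, smul_apply, smul_eq_mul]
  rw [h1]
  simp only [Matrix.toLpLin_apply, Matrix.mulVec, dotProduct, Matrix.of_apply]
  calc ∑ k, (∑ i, (∑ j, christoffel y z k i j * a j) * c i) *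
        gramForm y z (EuclideanSpace.single k 1) c
      = ∑ i, ∑ j, c i * a j * ∑ k, christoffel y z k i j *
          gramForm y z (EuclideanSpace.single k 1) c := by
        simp only [Finset.sum_mul, Finset.mul_sum]
        rw [Finset.sum_comm]
        refine Finset.sum_congr rfl fun i _ => ?_
        rw [Finset.sum_comm]
        exact Finset.sum_congr rfl fun j _ => Finset.sum_congr rfl fun k _ => by ring
    _ = 1 / 2 * (fderiv ℝ (gramForm y) z c a c + fderiv ℝ (gramForm y) z a c c -
          fderiv ℝ (gramForm y) z c c a) := by
        rw [trilin_eq_sum _ c a, trilin_eq_sum _ a c, bilin_eq_sum _ c a,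
          Finset.sum_comm (f := fun i j => a i * c j * _)]
        simp only [hΓ, ← Finset.sum_add_distrib, ← Finset.sum_sub_distrib, Finset.mul_sum]
        exact Finset.sum_congr rfl fun i _ => Finset.sum_congr rfl fun j _ => by ring
    _ = 1 / 2 * fderiv ℝ (gramForm y) z a c c := by
        rw [fderiv_gramForm_symm hz c a c]
        ring

/-- The Hessian in coordinates, written without Christoffel symbols: half of the Lie derivative of
the metric along the gradient. -/
def chartHess (f : N → ℝ) (y : N) (z c : EuclideanSpace ℝ (Fin n)) : ℝ :=
  1 / 2 * fderiv ℝ (gramForm y) z (chartGrad f y z) c c +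
    gramForm y z (fderiv ℝ (chartGrad f y) z c) c

set_option synthInstance.maxHeartbeats 200000 in
theorem hessian_self_eq_chartHess {f : N → ℝ} (hf : ContMDiff (𝓡 n) 𝓘(ℝ) ∞ f) (y : N)
    (v : TangentSpace (𝓡 n) y) :
    hessian f y v v = chartHess f y (extChartAt (𝓡 n) y y) (tangentCoord y y v) := by
  set z := extChartAt (𝓡 n) y y
  have hz : z ∈ (extChartAt (𝓡 n) y).target := mem_extChartAt_target y
  have hnhds := (isOpen_extChartAt_target (I := 𝓡 n) y).mem_nhds hz
  set c := tangentCoord y y v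
  set a := chartGrad f y z
  have hGd : HasFDerivAt (gramForm y) (fderiv ℝ (gramForm y) z) z :=
    (((contDiffOn_gramForm y).contDiffAt hnhds).differentiableAt (by simp)).hasFDerivAt
  have had : HasFDerivAt (chartGrad f y) (fderiv ℝ (chartGrad f y) z) z :=
    (((contDiffOn_chartGrad hf y).contDiffAt hnhds).differentiableAt (by simp)).hasFDerivAt
  have hfd : HasFDerivAt (fderiv ℝ (chartRep f y)) (fderiv ℝ (fderiv ℝ (chartRep f y)) z) z :=
    ((((contDiffOn_chartRep hf y).contDiffAt hnhds).fderiv_right (m := ∞)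
      (by simp)).differentiableAt (by simp)).hasFDerivAt
  have hsnd : ∀ i j : Fin n, fderiv ℝ (fun z' => fderiv ℝ (chartRep f y) z'
      (EuclideanSpace.single j (1 : ℝ))) z (EuclideanSpace.single i (1 : ℝ)) =
      fderiv ℝ (fderiv ℝ (chartRep f y)) z (EuclideanSpace.single i 1)
        (EuclideanSpace.single j 1) := fun i j => by
    rw [(hfd.clm_apply (hasFDerivAt_const (EuclideanSpace.single j (1 : ℝ)) z)).fderiv]
    simp only [add_apply, ContinuousLinearMap.comp_apply, ContinuousLinearMap.flip_apply,
      zero_apply, map_zero, zero_add]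
  -- Differentiate the identity `G(a) = df`.
  have hD : ∀ l w, fderiv ℝ (fderiv ℝ (chartRep f y)) z l w =
      fderiv ℝ (gramForm y) z l a w + gramForm y z (fderiv ℝ (chartGrad f y) z l) w := fun l w => by
    have h := hGd.clm_apply had
    have heq : (fun z' => gramForm y z' (chartGrad f y z')) =ᶠ[𝓝 z] fderiv ℝ (chartRep f y) := by
      filter_upwards [hnhds] with z' hz' using gramForm_chartGrad f hz'
    have h' := congrArg (fun T : EuclideanSpace ℝ (Fin n) →L[ℝ] EuclideanSpace ℝ (Fin n) →L[ℝ] ℝ =>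
      T l w) (hfd.unique (h.congr_of_eventuallyEq heq.symm))
    simp only [add_apply, ContinuousLinearMap.comp_apply, ContinuousLinearMap.flip_apply] at h'
    rw [h', add_comm]
  have hΓ : ∀ i j : Fin n, ∑ k, christoffel y z k i j *
      fderiv ℝ (chartRep f y) z (EuclideanSpace.single k (1 : ℝ)) =
      1 / 2 * (fderiv ℝ (gramForm y) z (EuclideanSpace.single i 1) (EuclideanSpace.single j 1) a +
        fderiv ℝ (gramForm y) z (EuclideanSpace.single j 1) (EuclideanSpace.single i 1) a -
        fderiv ℝ (gramForm y) z a (EuclideanSpace.single i 1) (EuclideanSpace.single j 1)) :=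
    fun i j => by
      rw [← sum_christoffel_mul_gramForm hz, ← gramForm_chartGrad f hz]
      exact Finset.sum_congr rfl fun k _ => by rw [gramForm_symm]
  calc hessian f y v v
      = ∑ i, ∑ j, c i * c j * (fderiv ℝ (fderiv ℝ (chartRep f y)) z (EuclideanSpace.single i 1)
          (EuclideanSpace.single j 1) - 1 / 2 *
          (fderiv ℝ (gramForm y) z (EuclideanSpace.single i 1) (EuclideanSpace.single j 1) a +
          fderiv ℝ (gramForm y) z (EuclideanSpace.single j 1) (EuclideanSpace.single i 1) a -
          fderiv ℝ (gramForm y) z a (EuclideanSpace.single i 1) (EuclideanSpace.single j 1))) := by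
        simp only [← hΓ, ← hsnd]
        rfl
    _ = fderiv ℝ (fderiv ℝ (chartRep f y)) z c c - 1 / 2 *
          (fderiv ℝ (gramForm y) z c c a + fderiv ℝ (gramForm y) z c c a -
            fderiv ℝ (gramForm y) z a c c) := by
        have hT := trilin_eq_sum (fderiv ℝ (gramForm y) z) c c a
        have hT' := hT
        rw [Finset.sum_comm] at hT'
        rw [bilin_eq_sum (fderiv ℝ (fderiv ℝ (chartRep f y)) z) c c,
          bilin_eq_sum (fderiv ℝ (gramForm y) z a) c c]
        nth_rewrite 1 [hT]
        rw [hT']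
        simp only [← Finset.sum_add_distrib, ← Finset.sum_sub_distrib, Finset.mul_sum]
        exact Finset.sum_congr rfl fun i _ => Finset.sum_congr rfl fun j _ => by ring
    _ = chartHess f y z c := by
        rw [hD, chartHess, fderiv_gramForm_symm hz c a c]
        ring

end Christoffel

/-! ### Invariance of the Hessian and covariant differential of the test field -/

section HessianInvariance

variable {n : ℕ} {N : Type*} [TopologicalSpace N] [ChartedSpace (EuclideanSpace ℝ (Fin n)) N]
  [IsManifold (𝓡 n) ∞ N]

theorem contDiffAt_chartTransition {y₀ y₁ y : N}
    (hy₀ : y ∈ (chartAt (EuclideanSpace ℝ (Fin n)) y₀).source)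
    (hy₁ : y ∈ (chartAt (EuclideanSpace ℝ (Fin n)) y₁).source) :
    ContDiffAt ℝ ∞ (extChartAt (𝓡 n) y₁ ∘ (extChartAt (𝓡 n) y₀).symm)
      (extChartAt (𝓡 n) y₀ y) := by
  have hz : extChartAt (𝓡 n) y₀ y ∈ (extChartAt (𝓡 n) y₀).target :=
    (extChartAt (𝓡 n) y₀).map_source (by simpa using hy₀)
  have h0 : ContMDiffAt 𝓘(ℝ, EuclideanSpace ℝ (Fin n)) (𝓡 n) ∞ (extChartAt (𝓡 n) y₀).symm
      (extChartAt (𝓡 n) y₀ y) :=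
    (contMDiffOn_extChartAt_symm y₀).contMDiffAt ((isOpen_extChartAt_target y₀).mem_nhds hz)
  have h1 : ContMDiffAt (𝓡 n) 𝓘(ℝ, EuclideanSpace ℝ (Fin n)) ∞ (extChartAt (𝓡 n) y₁)
      ((extChartAt (𝓡 n) y₀).symm (extChartAt (𝓡 n) y₀ y)) := by
    rw [(extChartAt (𝓡 n) y₀).left_inv (by simpa using hy₀)]
    exact contMDiffAt_extChartAt' hy₁
  exact (h1.comp _ h0).contDiffAt

theorem fderiv_chartTransition {y₀ y₁ y : N}
    (hy₀ : y ∈ (chartAt (EuclideanSpace ℝ (Fin n)) y₀).source)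
    (hy₁ : y ∈ (chartAt (EuclideanSpace ℝ (Fin n)) y₁).source) (v : TangentSpace (𝓡 n) y) :
    fderiv ℝ (extChartAt (𝓡 n) y₁ ∘ (extChartAt (𝓡 n) y₀).symm) (extChartAt (𝓡 n) y₀ y)
      (tangentCoord y₀ y v) = tangentCoord y₁ y v := by
  have hy' : y ∈ (extChartAt (𝓡 n) y₀).source := by simpa using hy₀
  have hd := (contDiffAt_chartTransition hy₀ hy₁).differentiableAt (by simp)
  have heq : extChartAt (𝓡 n) y₁ =ᶠ[𝓝 y]
      (extChartAt (𝓡 n) y₁ ∘ (extChartAt (𝓡 n) y₀).symm) ∘ extChartAt (𝓡 n) y₀ := by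
    filter_upwards [(isOpen_extChartAt_source (I := 𝓡 n) y₀).mem_nhds hy'] with y' hy'
    simp only [Function.comp_apply, (extChartAt (𝓡 n) y₀).left_inv hy']
  have h := (hd.hasFDerivAt.hasMFDerivAt.comp y
    (mdifferentiableAt_extChartAt (I := 𝓡 n) hy₀).hasMFDerivAt).congr_of_eventuallyEq heq
  have h' : tangentCoord y₁ y v = _ :=
    congrArg (fun T : TangentSpace (𝓡 n) y →L[ℝ] EuclideanSpace ℝ (Fin n) => T v) h.mfderiv
  exact h'.symm

variable [RiemannianBundle (fun y : N => TangentSpace (𝓡 n) y)]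
  [IsContMDiffRiemannianBundle (𝓡 n) ∞ (EuclideanSpace ℝ (Fin n))
      (fun y : N => TangentSpace (𝓡 n) y)]

/-- Both sides compute `½ (L_∇f g)(v, v)`, so that `half_lieDeriv_coordChange` applies to the
transition map of the two charts. -/
theorem chartHess_coordChange {f : N → ℝ} (hf : ContMDiff (𝓡 n) 𝓘(ℝ) ∞ f) {y₀ y₁ y : N}
    (hy₀ : y ∈ (chartAt (EuclideanSpace ℝ (Fin n)) y₀).source)
    (hy₁ : y ∈ (chartAt (EuclideanSpace ℝ (Fin n)) y₁).source) (v : TangentSpace (𝓡 n) y) :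
    chartHess f y₀ (extChartAt (𝓡 n) y₀ y) (tangentCoord y₀ y v) =
      chartHess f y₁ (extChartAt (𝓡 n) y₁ y) (tangentCoord y₁ y v) := by
  set τ := extChartAt (𝓡 n) y₁ ∘ (extChartAt (𝓡 n) y₀).symm
  set z := extChartAt (𝓡 n) y₀ y
  have hys : y ∈ (extChartAt (𝓡 n) y₀).source := by simpa using hy₀
  have hz₀ : z ∈ (extChartAt (𝓡 n) y₀).target := (extChartAt (𝓡 n) y₀).map_source hys
  have hτz : τ z = extChartAt (𝓡 n) y₁ y := by
    simp only [τ, z, Function.comp_apply, (extChartAt (𝓡 n) y₀).left_inv hys]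
  have hz₁ : extChartAt (𝓡 n) y₁ y ∈ (extChartAt (𝓡 n) y₁).target :=
    (extChartAt (𝓡 n) y₁).map_source (by simpa using hy₁)
  have hnhds₀ := (isOpen_extChartAt_target (I := 𝓡 n) y₀).mem_nhds hz₀
  have hnhds₁ := (isOpen_extChartAt_target (I := 𝓡 n) y₁).mem_nhds hz₁
  have hev : ∀ᶠ z' in 𝓝 z, ∃ y' ∈ (chartAt (EuclideanSpace ℝ (Fin n)) y₀).source,
      y' ∈ (chartAt (EuclideanSpace ℝ (Fin n)) y₁).source ∧ extChartAt (𝓡 n) y₀ y' = z' := by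
    have hc : ContinuousAt (extChartAt (𝓡 n) y₀).symm z :=
      continuousAt_extChartAt_symm' hys
    have hmem : (chartAt (EuclideanSpace ℝ (Fin n)) y₁).source ∈
        𝓝 ((extChartAt (𝓡 n) y₀).symm z) := by
      rw [(extChartAt (𝓡 n) y₀).left_inv hys]
      exact (chartAt (EuclideanSpace ℝ (Fin n)) y₁).open_source.mem_nhds hy₁
    filter_upwards [hnhds₀, hc.preimage_mem_nhds hmem] with z' hz' hz''
    exact ⟨(extChartAt (𝓡 n) y₀).symm z', by simpa using (extChartAt (𝓡 n) y₀).map_target hz',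
      hz'', (extChartAt (𝓡 n) y₀).right_inv hz'⟩
  have hτval : ∀ y' ∈ (chartAt (EuclideanSpace ℝ (Fin n)) y₀).source,
      τ (extChartAt (𝓡 n) y₀ y') = extChartAt (𝓡 n) y₁ y' := fun y' hy' => by
    simp only [τ, Function.comp_apply, (extChartAt (𝓡 n) y₀).left_inv
      (show y' ∈ (extChartAt (𝓡 n) y₀).source by simpa using hy')]
  have key := half_lieDeriv_coordChange (G₀ := gramForm y₀) (G₁ := gramForm y₁)
    (a₀ := chartGrad f y₀) (a₁ := chartGrad f y₁) (τ := τ) (z := z)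
    ((contDiffAt_chartTransition hy₀ hy₁).of_le (by norm_cast))
    (((contDiffOn_gramForm y₀).contDiffAt hnhds₀).differentiableAt (by simp))
    (hτz ▸ ((contDiffOn_gramForm y₁).contDiffAt hnhds₁).differentiableAt (by simp))
    (((contDiffOn_chartGrad hf y₀).contDiffAt hnhds₀).differentiableAt (by simp))
    (hτz ▸ ((contDiffOn_chartGrad hf y₁).contDiffAt hnhds₁).differentiableAt (by simp))
    (by
      filter_upwards [hev] with z' hz' v w
      obtain ⟨y', hy'₀, hy'₁, rfl⟩ := hz'
      rw [← tangentCoord_symmL hy'₀ v, ← tangentCoord_symmL hy'₀ w,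
        fderiv_chartTransition hy'₀ hy'₁, fderiv_chartTransition hy'₀ hy'₁, hτval y' hy'₀,
        gramForm_extChartAt_tangentCoord hy'₀, gramForm_extChartAt_tangentCoord hy'₁])
    (by
      filter_upwards [hev] with z' hz'
      obtain ⟨y', hy'₀, hy'₁, rfl⟩ := hz'
      rw [hτval y' hy'₀, ← tangentCoord_riemannianGrad hf hy'₀,
        ← tangentCoord_riemannianGrad hf hy'₁, fderiv_chartTransition hy'₀ hy'₁])
    (gramForm_symm _ _) (tangentCoord y₀ y v)
  rw [fderiv_chartTransition hy₀ hy₁, hτz] at key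
  exact key

theorem hessian_self_eq_chartHess_of_mem {f : N → ℝ} (hf : ContMDiff (𝓡 n) 𝓘(ℝ) ∞ f) {y₀ y : N}
    (hy : y ∈ (chartAt (EuclideanSpace ℝ (Fin n)) y₀).source) (v : TangentSpace (𝓡 n) y) :
    hessian f y v v = chartHess f y₀ (extChartAt (𝓡 n) y₀ y) (tangentCoord y₀ y v) := by
  rw [hessian_self_eq_chartHess hf, chartHess_coordChange hf (mem_chart_source _ y) hy]

end HessianInvariance

section CovariantDifferential

variable {n : ℕ} {N : Type*} [TopologicalSpace N] [ChartedSpace (EuclideanSpace ℝ (Fin n)) N]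
  [IsManifold (𝓡 n) ∞ N] [RiemannianBundle (fun y : N => TangentSpace (𝓡 n) y)]
  [IsContMDiffRiemannianBundle (𝓡 n) ∞ (EuclideanSpace ℝ (Fin n))
      (fun y : N => TangentSpace (𝓡 n) y)]
  {d : ℕ} {H : Type*} [TopologicalSpace H]
  {I : ModelWithCorners ℝ (EuclideanSpace ℝ (Fin d)) H}
  {M : Type*} [TopologicalSpace M] [ChartedSpace H M]

set_option synthInstance.maxHeartbeats 200000 in
/-- The covariant differential of `φ(f ∘ u) ∇f`, paired with `du`. -/
theorem inner_mfderiv_covDifferential {f : N → ℝ} (hf : ContMDiff (𝓡 n) 𝓘(ℝ) ∞ f) {φ : ℝ → ℝ}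
    (hφ : Differentiable ℝ φ) {u : M → N} {x : M} (hu : MDifferentiableAt I (𝓡 n) u x)
    (v : TangentSpace I x) :
    inner ℝ (mfderiv I (𝓡 n) u x v)
      (covDifferential I u (fun x' => φ (f (u x')) • riemannianGrad f (u x')) x v) =
      deriv φ (f (u x)) * (inner ℝ (riemannianGrad f (u x)) (mfderiv I (𝓡 n) u x v)) ^ 2 +
        φ (f (u x)) * hessian f (u x) (mfderiv I (𝓡 n) u x v) (mfderiv I (𝓡 n) u x v) := by
  set y := u x
  set z := extChartAt (𝓡 n) y y
  have hsrc := mem_chart_source (EuclideanSpace ℝ (Fin n)) y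
  have hz : z ∈ (extChartAt (𝓡 n) y).target := mem_extChartAt_target y
  have hnhds := (isOpen_extChartAt_target (I := 𝓡 n) y).mem_nhds hz
  set c := tangentCoord y y (mfderiv I (𝓡 n) u x v)
  set a := chartGrad f y z
  have hfz : chartRep f y z = f y := by
    simp only [chartRep, z, (extChartAt (𝓡 n) y).left_inv (mem_extChartAt_source y)]
  have had : HasFDerivAt (chartGrad f y) (fderiv ℝ (chartGrad f y) z) z :=
    (((contDiffOn_chartGrad hf y).contDiffAt hnhds).differentiableAt (by simp)).hasFDerivAt
  have hfd : HasFDerivAt (chartRep f y) (fderiv ℝ (chartRep f y) z) z :=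
    (((contDiffOn_chartRep hf y).contDiffAt hnhds).differentiableAt (by simp)).hasFDerivAt
  -- The coordinates of the vector field are a function of the coordinates of `u`.
  have hK := ((hφ (chartRep f y z)).hasDerivAt.comp_hasFDerivAt z hfd).smul had
  have hψu : HasMFDerivAt I 𝓘(ℝ, EuclideanSpace ℝ (Fin n)) (extChartAt (𝓡 n) y ∘ u) x
      ((tangentCoord y y).comp (mfderiv I (𝓡 n) u x)) :=
    (mdifferentiableAt_extChartAt (I := 𝓡 n) hsrc).hasMFDerivAt.comp x hu.hasMFDerivAt
  have hXc : (fun x' : M => tangentCoord y (u x') (φ (f (u x')) • riemannianGrad f (u x'))) =ᶠ[𝓝 x]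
      ((fun z' => φ (chartRep f y z') • chartGrad f y z') ∘ (extChartAt (𝓡 n) y ∘ u)) := by
    filter_upwards [hu.continuousAt.preimage_mem_nhds
      (chart_source_mem_nhds (EuclideanSpace ℝ (Fin n)) (u x))] with x' hx'
    have hx'' : u x' ∈ (extChartAt (𝓡 n) y).source := by simpa using hx'
    rw [map_smul, tangentCoord_riemannianGrad hf (y₀ := y) hx']
    simp only [Function.comp_apply, chartRep]
    rw [(extChartAt (𝓡 n) y).left_inv hx'']
  have hdXc := ((hK.hasMFDerivAt.comp x hψu).congr_of_eventuallyEq hXc).mfderiv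
  have hcov : tangentCoord y y
      (covDifferential I u (fun x' => φ (f (u x')) • riemannianGrad f (u x')) x v) =
      φ (f y) • fderiv ℝ (chartGrad f y) z c +
        (deriv φ (f y) * fderiv ℝ (chartRep f y) z c) • a +
        Matrix.toEuclideanLin (𝕜 := ℝ)
          (Matrix.of fun k i => ∑ j, christoffel y z k i j * (φ (f y) • a) j) c := by
    have hval : tangentCoord y (u x) (φ (f (u x)) • riemannianGrad f (u x)) = φ (f y) • a := by
      rw [map_smul, tangentCoord_riemannianGrad hf hsrc]
    refine (tangentCoord_tangentOfCoord y _).trans ?_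
    refine (LinearMap.add_apply _ _ v).trans (congrArg₂ (· + ·) ?_ ?_)
    · refine (congrArg (fun T : TangentSpace I x →L[ℝ] EuclideanSpace ℝ (Fin n) => T v)
        hdXc).trans ?_
      rw [hfz]
      simp only [Function.comp_apply, hfz]
      rfl
    · rw [← hval]
      rfl
  rw [← gramForm_extChartAt_tangentCoord hsrc, hcov, map_add, map_add, map_smul, map_smul,
    gramForm_christoffel hz, gramForm_symm, gramForm_symm y z c a, gramForm_chartGrad f hz,
    fderiv_chartRep_tangentCoord hf hsrc, ← inner_riemannianGrad hf,
    hessian_self_eq_chartHess hf, chartHess, map_smul]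
  simp only [smul_eq_mul, smul_apply]
  ring

end CovariantDifferential

/-! ### Continuity of the Hessian and of Hilbert–Schmidt products -/

section Continuity

theorem continuousAt_fderiv_apply {E F : Type*} [NormedAddCommGroup E] [NormedSpace ℝ E]
    [NormedAddCommGroup F] [NormedSpace ℝ F] {g : E → F} {s : Set E} (hs : IsOpen s)
    (hg : ContDiffOn ℝ ∞ g s) {X : Type*} [TopologicalSpace X] {ζ c : X → E} {x₀ : X}
    (hζ : ContinuousAt ζ x₀) (hc : ContinuousAt c x₀) (hx₀ : ζ x₀ ∈ s) :
    ContinuousAt (fun x => fderiv ℝ g (ζ x) (c x)) x₀ := by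
  have h : ContinuousAt (fun x => fderiv ℝ g (ζ x)) x₀ :=
    ((hg.continuousOn_fderiv_of_isOpen hs (by simp)).continuousAt (hs.mem_nhds hx₀)).comp hζ
  exact h.clm_apply hc

theorem continuousAt_half_lieDeriv {E : Type*} [NormedAddCommGroup E] [NormedSpace ℝ E]
    {G : E → E →L[ℝ] E →L[ℝ] ℝ} {a : E → E} {s : Set E} (hs : IsOpen s)
    (hG : ContDiffOn ℝ ∞ G s) (ha : ContDiffOn ℝ ∞ a s) {X : Type*} [TopologicalSpace X]
    {ζ c : X → E} {x₀ : X} (hζ : ContinuousAt ζ x₀) (hc : ContinuousAt c x₀) (hx₀ : ζ x₀ ∈ s) :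
    ContinuousAt (fun x => 1 / 2 * fderiv ℝ G (ζ x) (a (ζ x)) (c x) (c x) +
      G (ζ x) (fderiv ℝ a (ζ x) (c x)) (c x)) x₀ := by
  have hnhds := hs.mem_nhds hx₀
  have hGζ : ContinuousAt (fun x => G (ζ x)) x₀ :=
    (hG.continuousOn.continuousAt hnhds).comp hζ
  have haζ : ContinuousAt (fun x => a (ζ x)) x₀ :=
    (ha.continuousOn.continuousAt hnhds).comp hζ
  have hDG := continuousAt_fderiv_apply hs hG hζ haζ hx₀
  have hDa := continuousAt_fderiv_apply hs ha hζ hc hx₀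
  exact (continuousAt_const.mul ((hDG.clm_apply hc).clm_apply hc)).add
    ((hGζ.clm_apply hDa).clm_apply hc)

variable {d : ℕ} {H : Type*} [TopologicalSpace H]
  {I : ModelWithCorners ℝ (EuclideanSpace ℝ (Fin d)) H}
  {M : Type*} [TopologicalSpace M] [ChartedSpace H M] [IsManifold I ∞ M]

theorem continuousAt_coordFrame_add (x₀ : M) (i j : Fin d) :
    ContinuousAt (fun x => (⟨x, coordFrame I x₀ i x + coordFrame I x₀ j x⟩ : TangentBundle I M))
      x₀ := by
  have h := fun i => (contMDiffAt_coordFrame (I := I) (mem_chart_source H x₀) i)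
  exact ((h i).add_section (h j)).continuousAt

section

variable [RiemannianBundle (fun x : M => TangentSpace I x)]
  [IsContMDiffRiemannianBundle I ∞ (EuclideanSpace ℝ (Fin d)) (fun x : M => TangentSpace I x)]

theorem continuousAt_inner_tangent {X : Type*} [TopologicalSpace X] {b : X → M}
    {v w : ∀ x, TangentSpace I (b x)} {x : X}
    (hv : ContinuousAt (fun x => (⟨b x, v x⟩ : TangentBundle I M)) x)
    (hw : ContinuousAt (fun x => (⟨b x, w x⟩ : TangentBundle I M)) x) :
    ContinuousAt (fun x => (inner ℝ (v x) (w x) : ℝ)) x := by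
  have h : IsContinuousRiemannianBundle (EuclideanSpace ℝ (Fin d))
      (fun x : M => TangentSpace I x) := by
    obtain ⟨g, hg, hg'⟩ := IsContMDiffRiemannianBundle.exists_contMDiff (IB := I) (n := ∞)
      (F := EuclideanSpace ℝ (Fin d)) (E := fun x : M => TangentSpace I x)
    exact ⟨g, hg.continuous, hg'⟩
  exact ContinuousAt.inner_bundle (E := fun x : M => TangentSpace I x) (b := b) hv hw

/-- Continuity of a Hilbert–Schmidt product may be tested on the diagonal of the bilinear form
`(v, w) ↦ ⟪A v, B w⟫`, along continuous vector fields: the inverse of the Gram matrix of a frame is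
symmetric, so that only the symmetric part of the bilinear form matters. -/
theorem continuousAt_hsInner {W : M → Type*} [∀ x, NormedAddCommGroup (W x)]
    [∀ x, InnerProductSpace ℝ (W x)] (A B : ∀ x, TangentSpace I x →ₗ[ℝ] W x) (x₀ : M)
    (h : ∀ e : ∀ x : M, TangentSpace I x,
      ContinuousAt (fun x => (⟨x, e x⟩ : TangentBundle I M)) x₀ →
        ContinuousAt (fun x => (inner ℝ (A x (e x)) (B x (e x)) : ℝ)) x₀) :
    ContinuousAt (fun x => hsInner (V := TangentSpace I x) (A x) (B x)) x₀ := by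
  let G : M → Matrix (Fin d) (Fin d) ℝ := fun x => Matrix.gram ℝ fun i => coordFrame I x₀ i x
  let q : Fin d → Fin d → M → ℝ := fun i j x =>
    inner ℝ (A x (coordFrame I x₀ i x + coordFrame I x₀ j x))
      (B x (coordFrame I x₀ i x + coordFrame I x₀ j x))
  have hq : ∀ i j, ContinuousAt (q i j) x₀ := fun i j => h _ (continuousAt_coordFrame_add x₀ i j)
  have hGc : ContinuousAt G x₀ := by
    refine continuousAt_pi.2 fun i => continuousAt_pi.2 fun j => ?_
    exact (contMDiffAt_inner_coordFrame (I := I) (mem_chart_source H x₀) i j).continuousAt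
  have hdet : (G x₀).det ≠ 0 := by
    have hb := (coordBasis (I := I) (mem_chart_source H x₀)).linearIndependent
    have hc : (coordBasis (I := I) (mem_chart_source H x₀) : Fin d → TangentSpace I x₀) =
        fun i => coordFrame I x₀ i x₀ := funext fun i => coordBasis_apply _ i
    rw [hc] at hb
    exact (Matrix.posDef_gram_of_linearIndependent hb).det_pos.ne'
  have hGinv : ContinuousAt (fun x => (G x)⁻¹) x₀ := by
    refine ContinuousAt.comp (g := fun A : Matrix (Fin d) (Fin d) ℝ => A⁻¹)
      (continuousAt_matrix_inv _ ?_) hGc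
    simpa only [Ring.inverse_eq_inv'] using continuousAt_inv₀ hdet
  have hGinv' : ∀ i j, ContinuousAt (fun x => (G x)⁻¹ i j) x₀ := fun i j =>
    continuousAt_pi.1 (continuousAt_pi.1 hGinv i) j
  have heq : (fun x => hsInner (V := TangentSpace I x) (A x) (B x)) =ᶠ[𝓝 x₀]
      fun x => ∑ i, ∑ j, (G x)⁻¹ i j * (1 / 2 * (q i j x - q i i x / 4 - q j j x / 4)) := by
    filter_upwards [chart_source_mem_nhds H x₀] with x hx
    have hGx : Matrix.gram ℝ (coordBasis (I := I) hx) = G x := by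
      ext i j
      simp only [G, Matrix.gram_apply, coordBasis_apply]
    have hsymm : ∀ i j, (G x)⁻¹ j i = (G x)⁻¹ i j := fun i j => by
      have : ((G x)⁻¹).transpose = (G x)⁻¹ := by
        rw [Matrix.transpose_nonsing_inv]
        congr 1
        ext i j
        exact real_inner_comm (F := TangentSpace I x) _ _
      exact congrFun (congrFun this i) j
    rw [hsInner_eq_sum_gram_inv (coordBasis (I := I) hx), hGx]
    simp only [coordBasis_apply]
    set C : Fin d → Fin d → ℝ := fun i j =>
      inner ℝ (A x (coordFrame I x₀ i x)) (B x (coordFrame I x₀ j x)) with hC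
    have hqC : ∀ i j, 1 / 2 * (q i j x - q i i x / 4 - q j j x / 4) = 1 / 2 * (C i j + C j i) :=
      fun i j => by
        simp only [q, hC, map_add, inner_add_left, inner_add_right]
        ring
    simp only [hqC]
    have h1 : ∑ i, ∑ j, (G x)⁻¹ i j * C i j = ∑ i, ∑ j, (G x)⁻¹ i j * C j i := by
      rw [Finset.sum_comm]
      exact Finset.sum_congr rfl fun i _ => Finset.sum_congr rfl fun j _ => by rw [hsymm]
    calc ∑ i, ∑ j, (G x)⁻¹ i j * C i j
        = 1 / 2 * (∑ i, ∑ j, (G x)⁻¹ i j * C i j) + 1 / 2 * ∑ i, ∑ j, (G x)⁻¹ i j * C j i := by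
          rw [← h1]
          ring
      _ = _ := by
          simp only [Finset.mul_sum, ← Finset.sum_add_distrib]
          exact Finset.sum_congr rfl fun i _ => Finset.sum_congr rfl fun j _ => by ring
  refine ContinuousAt.congr ?_ heq.symm
  refine tendsto_finsetSum _ fun i _ => tendsto_finsetSum _ fun j _ => ?_
  exact (hGinv' i j).mul (continuousAt_const.mul
    (((hq i j).sub ((hq i i).div_const 4)).sub ((hq j j).div_const 4)))

end

variable {n : ℕ} {N : Type*} [TopologicalSpace N] [ChartedSpace (EuclideanSpace ℝ (Fin n)) N]
  [IsManifold (𝓡 n) ∞ N]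

theorem continuousAt_mfderiv_apply {u : M → N} (hu : ContMDiff I (𝓡 n) 1 u)
    {e : ∀ x : M, TangentSpace I x} {x₀ : M}
    (he : ContinuousAt (fun x => (⟨x, e x⟩ : TangentBundle I M)) x₀) :
    ContinuousAt (fun x => (⟨u x, mfderiv I (𝓡 n) u x (e x)⟩ : TangentBundle (𝓡 n) N)) x₀ :=
  (hu.continuous_tangentMap le_rfl).continuousAt.comp he

variable [RiemannianBundle (fun y : N => TangentSpace (𝓡 n) y)]
  [IsContMDiffRiemannianBundle (𝓡 n) ∞ (EuclideanSpace ℝ (Fin n))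
      (fun y : N => TangentSpace (𝓡 n) y)]

/-- The Hessian is continuous, although its definition at `y` involves the preferred chart at `y`,
which may depend on `y` in an arbitrary way. -/
theorem continuousAt_hessian_self {f : N → ℝ} (hf : ContMDiff (𝓡 n) 𝓘(ℝ) ∞ f) {X : Type*}
    [TopologicalSpace X] {b : X → N} {v : ∀ x, TangentSpace (𝓡 n) (b x)} {x₀ : X}
    (hv : ContinuousAt (fun x => (⟨b x, v x⟩ : TangentBundle (𝓡 n) N)) x₀) :
    ContinuousAt (fun x => hessian f (b x) (v x) (v x)) x₀ := by
  obtain ⟨hb, hc⟩ := (FiberBundle.continuousAt_totalSpace _ _).1 hv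
  have hb : ContinuousAt b x₀ := hb
  have hsrc := hb.preimage_mem_nhds (chart_source_mem_nhds (EuclideanSpace ℝ (Fin n)) (b x₀))
  have hc' : ContinuousAt (fun x => tangentCoord (b x₀) (b x) (v x)) x₀ := by
    refine hc.congr ?_
    filter_upwards [hsrc] with x hx
    rw [tangentCoord_eq_continuousLinearMapAt hx]
    exact (Trivialization.continuousLinearMapAt_apply_of_mem _ _ (by simpa using hx) _).symm
  have hψ : ContinuousAt (fun x => extChartAt (𝓡 n) (b x₀) (b x)) x₀ :=
    (continuousAt_extChartAt (b x₀)).comp hb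
  have key : ContinuousAt (fun x => chartHess f (b x₀) (extChartAt (𝓡 n) (b x₀) (b x))
      (tangentCoord (b x₀) (b x) (v x))) x₀ :=
    continuousAt_half_lieDeriv (isOpen_extChartAt_target (b x₀)) (contDiffOn_gramForm (b x₀))
      (contDiffOn_chartGrad hf (b x₀)) hψ hc' (mem_extChartAt_target (b x₀))
  refine key.congr ?_
  filter_upwards [hsrc] with x hx
  exact (hessian_self_eq_chartHess_of_mem hf hx (v x)).symm

end Continuity

/-! ### The weak maximum principle -/

section LocallyConstant

/-- Boundary points are allowed: in a chart, the range of the model is convex, and the mean value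
inequality applies within it. -/
theorem isLocallyConstant_of_mfderiv_eq_zero {E : Type*} [NormedAddCommGroup E] [NormedSpace ℝ E]
    {H : Type*} [TopologicalSpace H] {I : ModelWithCorners ℝ E H} {M : Type*} [TopologicalSpace M]
    [ChartedSpace H M] [IsManifold I 1 M] {h : M → ℝ} (hd : MDifferentiable I 𝓘(ℝ) h)
    (h0 : ∀ x, mfderiv I 𝓘(ℝ) h x = 0) : IsLocallyConstant h := by
  refine (IsLocallyConstant.iff_eventually_eq h).2 fun x => ?_
  obtain ⟨r, hr, hrs⟩ := Metric.mem_nhdsWithin_iff.1 (extChartAt_target_mem_nhdsWithin (I := I) x)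
  set s := Metric.ball (extChartAt I x x) r ∩ range I
  have hs : Convex ℝ s := (convex_ball _ _).inter I.convex_range
  have hderiv : ∀ z ∈ s, HasFDerivWithinAt (h ∘ (extChartAt I x).symm) (0 : E →L[ℝ] ℝ) s z := by
    intro z hz
    have h1 := (hd ((extChartAt I x).symm z)).hasMFDerivAt
    rw [h0] at h1
    have h2 := h1.comp_hasMFDerivWithinAt z
      ((mdifferentiableWithinAt_extChartAt_symm (hrs hz)).mono inter_subset_right :
        MDifferentiableWithinAt 𝓘(ℝ, E) I (extChartAt I x).symm s z).hasMFDerivWithinAt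
    rw [ContinuousLinearMap.zero_comp] at h2
    exact h2.hasFDerivWithinAt
  have hconst : ∀ z ∈ s, h ((extChartAt I x).symm z) = h x := by
    intro z hz
    have hx : extChartAt I x x ∈ s := ⟨Metric.mem_ball_self hr, mem_range_self _⟩
    have hle := hs.norm_image_sub_le_of_norm_hasFDerivWithin_le (C := 0) hderiv (by simp) hx hz
    rw [zero_mul, norm_le_zero_iff, sub_eq_zero] at hle
    simpa only [Function.comp_apply, extChartAt_to_inv] using hle
  have hball := (continuousAt_extChartAt (I := I) x).preimage_mem_nhds (Metric.ball_mem_nhds _ hr)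
  filter_upwards [hball, extChartAt_source_mem_nhds (I := I) x] with y hy hys
  have := hconst (extChartAt I x y) ⟨hy, mem_range_self _⟩
  rwa [(extChartAt I x).left_inv hys] at this

end LocallyConstant

section MaximumPrinciple

variable {d : ℕ} {H : Type*} [TopologicalSpace H]
  {I : ModelWithCorners ℝ (EuclideanSpace ℝ (Fin d)) H}
  {M : Type*} [TopologicalSpace M] [ChartedSpace H M]
  [RiemannianBundle (fun x : M => TangentSpace I x)]
  {n : ℕ} {N : Type*} [TopologicalSpace N] [ChartedSpace (EuclideanSpace ℝ (Fin n)) N]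
  [IsManifold (𝓡 n) ∞ N] [RiemannianBundle (fun y : N => TangentSpace (𝓡 n) y)]
  [IsContMDiffRiemannianBundle (𝓡 n) ∞ (EuclideanSpace ℝ (Fin n))
      (fun y : N => TangentSpace (𝓡 n) y)]

/-- The integrand of the weak equation, for the test field `φ(f ∘ u) ∇f`: it is the sum of
`φ'(f ∘ u) |d(f ∘ u)|²` and of `φ(f ∘ u) tr Hess f (du, du)`. -/
theorem hsTangent_mfderiv_covDifferential {f : N → ℝ} (hf : ContMDiff (𝓡 n) 𝓘(ℝ) ∞ f) {φ : ℝ → ℝ}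
    (hφ : Differentiable ℝ φ) {u : M → N} {x : M} (hu : MDifferentiableAt I (𝓡 n) u x) :
    hsTangent I x (u x) (mfderiv I (𝓡 n) u x).toLinearMap
      (covDifferential I u (fun x' => φ (f (u x')) • riemannianGrad f (u x')) x) =
      ∑ k, (deriv φ (f (u x)) * (inner ℝ (riemannianGrad f (u x))
          (mfderiv I (𝓡 n) u x (stdOrthonormalBasis ℝ (TangentSpace I x) k))) ^ 2 +
        φ (f (u x)) * hessian f (u x)
          (mfderiv I (𝓡 n) u x (stdOrthonormalBasis ℝ (TangentSpace I x) k))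
          (mfderiv I (𝓡 n) u x (stdOrthonormalBasis ℝ (TangentSpace I x) k))) := by
  unfold hsTangent hsInner
  exact Finset.sum_congr rfl fun k _ => inner_mfderiv_covDifferential hf hφ hu
    (stdOrthonormalBasis ℝ (TangentSpace I x) k)

/-- Where the integrand of the weak equation vanishes, either `du = 0` or `φ'(f ∘ u) d(f ∘ u) = 0`.
In both cases `d(φ(f ∘ u)) = 0`. -/
theorem mfderiv_comp_eq_zero_of_integrand_eq_zero {f : N → ℝ} (hf : IsSmoothConvex (n := n) f)
    {φ : ℝ → ℝ} (hφ : Differentiable ℝ φ) (hφ0 : ∀ t, 0 ≤ φ t) (hφm : Monotone φ) {u : M → N}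
    {x : M} (hu : MDifferentiableAt I (𝓡 n) u x) {q : ℝ}
    (h0 : normDifferential (n := n) I u x ^ q *
      hsTangent I x (u x) (mfderiv I (𝓡 n) u x).toLinearMap
        (covDifferential I u (fun x' => φ (f (u x')) • riemannianGrad f (u x')) x) = 0) :
    mfderiv I 𝓘(ℝ) (fun x => φ (f (u x))) x = 0 := by
  have hchain : ∀ v : TangentSpace I x, mfderiv I 𝓘(ℝ) (fun x => φ (f (u x))) x v =
      deriv φ (f (u x)) * inner ℝ (riemannianGrad f (u x)) (mfderiv I (𝓡 n) u x v) := fun v => by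
    have h := (hφ (f (u x))).hasDerivAt.hasFDerivAt.hasMFDerivAt.comp x
      (((hf.1.mdifferentiable (by simp)) (u x)).hasMFDerivAt.comp x hu.hasMFDerivAt)
    have h' : mfderiv I 𝓘(ℝ) (fun x => φ (f (u x))) x v = _ :=
      congrArg (fun T : TangentSpace I x →L[ℝ] ℝ => T v) h.mfderiv
    rw [h', inner_riemannianGrad hf.1]
    exact mul_comm (_ : ℝ) _
  -- For `q = 0` the first factor is `1`, also at the zeros of `du`, and only the second case
  -- occurs.
  rcases mul_eq_zero.1 h0 with h | h
  · -- The differential of `u` vanishes.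
    have hnorm : hsInner (V := TangentSpace I x) (W := TangentSpace (𝓡 n) (u x))
        (mfderiv I (𝓡 n) u x).toLinearMap (mfderiv I (𝓡 n) u x).toLinearMap = 0 :=
      (Real.sqrt_eq_zero (hsInner_self_nonneg _)).1
        ((Real.rpow_eq_zero_iff_of_nonneg (Real.sqrt_nonneg _)).1 h).1
    have hdu := hsInner_self_eq_zero hnorm
    ext v
    have hv : mfderiv I (𝓡 n) u x v = 0 := LinearMap.congr_fun hdu v
    rw [hchain, hv, inner_zero_right, mul_zero]
    rfl
  · -- All the terms of the trace are nonnegative.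
    rw [hsTangent_mfderiv_covDifferential hf.1 hφ hu,
      Finset.sum_eq_zero_iff_of_nonneg fun k _ => add_nonneg
        (mul_nonneg hφm.deriv_nonneg (sq_nonneg _)) (mul_nonneg (hφ0 _) (hf.2 _ _))] at h
    have hzero : ∀ k, mfderiv I 𝓘(ℝ) (fun x => φ (f (u x))) x
        (stdOrthonormalBasis ℝ (TangentSpace I x) k) = 0 := fun k => by
      have hk := (add_eq_zero_iff_of_nonneg (mul_nonneg hφm.deriv_nonneg (sq_nonneg _))
        (mul_nonneg (hφ0 _) (hf.2 _ _))).1 (h k (Finset.mem_univ k))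
      have hk1 := hk.1
      rw [mul_eq_zero, sq_eq_zero_iff, ← mul_eq_zero] at hk1
      rw [hchain]
      exact hk1
    have hlin : (mfderiv I 𝓘(ℝ) (fun x => φ (f (u x))) x).toLinearMap = 0 :=
      (stdOrthonormalBasis ℝ (TangentSpace I x)).toBasis.ext fun k => by
        rw [OrthonormalBasis.coe_toBasis]
        exact hzero k
    exact ContinuousLinearMap.coe_injective hlin

theorem integrand_nonneg {f : N → ℝ} (hf : IsSmoothConvex (n := n) f)
    {φ : ℝ → ℝ} (hφ : Differentiable ℝ φ) (hφ0 : ∀ t, 0 ≤ φ t) (hφm : Monotone φ) {u : M → N}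
    {x : M} (hu : MDifferentiableAt I (𝓡 n) u x) {q : ℝ} :
    0 ≤ normDifferential (n := n) I u x ^ q *
      hsTangent I x (u x) (mfderiv I (𝓡 n) u x).toLinearMap
        (covDifferential I u (fun x' => φ (f (u x')) • riemannianGrad f (u x')) x) := by
  rw [hsTangent_mfderiv_covDifferential hf.1 hφ hu]
  exact mul_nonneg (Real.rpow_nonneg (Real.sqrt_nonneg _) _) (Finset.sum_nonneg fun k _ =>
    add_nonneg (mul_nonneg hφm.deriv_nonneg (sq_nonneg _)) (mul_nonneg (hφ0 _) (hf.2 _ _)))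

variable [IsManifold I ∞ M] [IsContMDiffRiemannianBundle I ∞ (EuclideanSpace ℝ (Fin d))
      (fun x : M => TangentSpace I x)]

/-- Continuity of the integrand, which makes it integrable, so that the vanishing of its Bochner
integral is not a convention. -/
theorem continuous_integrand {f : N → ℝ} (hf : ContMDiff (𝓡 n) 𝓘(ℝ) ∞ f) {φ : ℝ → ℝ}
    (hφ : ContDiff ℝ 1 φ) {u : M → N} (hu : ContMDiff I (𝓡 n) 1 u) {q : ℝ} (hq : 0 ≤ q) :
    Continuous fun x => normDifferential (n := n) I u x ^ q *
      hsTangent I x (u x) (mfderiv I (𝓡 n) u x).toLinearMap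
        (covDifferential I u (fun x' => φ (f (u x')) • riemannianGrad f (u x')) x) := by
  have h1 : Continuous fun x => normDifferential (n := n) I u x := by
    refine Continuous.sqrt (continuous_iff_continuousAt.2 fun x₀ => ?_)
    refine continuousAt_hsInner (I := I) (W := fun x => TangentSpace (𝓡 n) (u x)) _ _ x₀
      fun e he => ?_
    exact continuousAt_inner_tangent (continuousAt_mfderiv_apply hu he)
      (continuousAt_mfderiv_apply hu he)
  have h2 : Continuous fun x => hsTangent I x (u x) (mfderiv I (𝓡 n) u x).toLinearMap
        (covDifferential I u (fun x' => φ (f (u x')) • riemannianGrad f (u x')) x) := by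
    refine continuous_iff_continuousAt.2 fun x₀ => ?_
    refine continuousAt_hsInner (I := I) (W := fun x => TangentSpace (𝓡 n) (u x)) _ _ x₀
      fun e he => ?_
    have hdu := continuousAt_mfderiv_apply hu he
    have hfu : ContinuousAt (fun x => f (u x)) x₀ :=
      (hf.continuous.comp hu.continuous).continuousAt
    have hgrad : ContinuousAt
        (fun x => (⟨u x, riemannianGrad f (u x)⟩ : TangentBundle (𝓡 n) N)) x₀ :=
      ((contMDiff_riemannianGrad hf).continuous.comp hu.continuous).continuousAt
    have hφ' : Continuous (deriv φ) := hφ.continuous_deriv le_rfl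
    refine ContinuousAt.congr (((hφ'.continuousAt.comp hfu).mul
      ((continuousAt_inner_tangent hgrad hdu).pow 2)).add
        ((hφ.continuous.continuousAt.comp hfu).mul (continuousAt_hessian_self hf hdu))) ?_
    filter_upwards with x
    exact (inner_mfderiv_covDifferential hf (hφ.differentiable (by simp))
      (hu.mdifferentiable (by simp) x) (e x)).symm
  exact (h1.rpow_const fun _ => Or.inr hq).mul h2

variable [T2Space M] [CompactSpace M] [MeasurableSpace M] [BorelSpace M]

/-- The weak equation is tested on `φ(f ∘ u) ∇f`, with the smooth monotone cut-off
`φ(t) = expNegInvGlue (t - c)`, which vanishes exactly for `t ≤ c`. -/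
theorem IsPHarmonic.comp_le_of_boundary_lt
    (hM : ∀ x : M, (connectedComponent x ∩ I.boundary M).Nonempty) {p : ℝ} (hp : 2 ≤ p)
    {u : M → N} (hu : IsPHarmonic (n := n) I p u) {f : N → ℝ} (hf : IsSmoothConvex (n := n) f)
    {c : ℝ} (hc : ∀ x ∈ I.boundary M, f (u x) < c) (x : M) : f (u x) ≤ c := by
  set φ : ℝ → ℝ := fun t => expNegInvGlue (t - c) with hφ
  have hφs : ContDiff ℝ ∞ φ := expNegInvGlue.contDiff.comp (contDiff_id.sub contDiff_const)
  have hφd : Differentiable ℝ φ := hφs.differentiable (by simp)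
  have hφ0 : ∀ t, 0 ≤ φ t := fun t => expNegInvGlue.nonneg _
  have hφm : Monotone φ := fun s t hst => expNegInvGlue.monotone (sub_le_sub_right hst c)
  have hφz : ∀ t, φ t = 0 ↔ t ≤ c := fun t => by
    simp only [hφ, expNegInvGlue.zero_iff_nonpos, sub_nonpos]
  have hw : Continuous fun x => f (u x) := hf.1.continuous.comp hu.1.continuous
  have hud : MDifferentiable I (𝓡 n) u := hu.1.mdifferentiable (by simp)
  set X : ∀ x : M, TangentSpace (𝓡 n) (u x) := fun x => φ (f (u x)) • riemannianGrad f (u x)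
    with hX
  have hXs : ContMDiff I (𝓡 n).tangent 1 (fun x => (⟨u x, X x⟩ : TangentBundle (𝓡 n) N)) := by
    have h : ContMDiff (𝓡 n) (𝓡 n).tangent ∞
        (fun y => (⟨y, φ (f y) • riemannianGrad f y⟩ : TangentBundle (𝓡 n) N)) :=
      (hφs.contMDiff.comp hf.1).smul_section (contMDiff_riemannianGrad hf.1)
    exact (h.of_le (by simp)).comp hu.1
  have hsupp : closure {x | X x ≠ 0} ⊆ {x | c ≤ f (u x)} := by
    refine closure_minimal (fun x hx => ?_) (isClosed_le continuous_const hw)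
    by_contra hlt
    refine hx ?_
    simp only [hX]
    rw [(hφz _).2 (not_le.1 hlt).le, zero_smul]
  have hint := hu.2 X hXs isClosed_closure.isCompact fun x hx => by
    rw [← ModelWithCorners.compl_boundary]
    exact fun hxb => absurd (hsupp hx) (not_le.2 (hc x hxb))
  have := isFiniteMeasure_riemannianVolume (I := I) (M := M)
  have := isOpenPosMeasure_riemannianVolume (I := I) (M := M)
  have hcont := continuous_integrand hf.1 (hφs.of_le (by simp)) hu.1
    (show 0 ≤ p - 2 by linarith)
  have hzero := hcont.ae_eq_iff_eq (riemannianVolume I M) continuous_zero |>.1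
    ((integral_eq_zero_iff_of_nonneg (fun x => integrand_nonneg hf hφd hφ0 hφm (hud x))
      (hcont.integrable_of_hasCompactSupport (HasCompactSupport.of_compactSpace _))).1 hint)
  have hd : MDifferentiable I 𝓘(ℝ) fun x => φ (f (u x)) :=
    (hφd.mdifferentiable.comp (hf.1.mdifferentiable (by simp))).comp hud
  have hconst := isLocallyConstant_of_mfderiv_eq_zero hd fun x =>
    mfderiv_comp_eq_zero_of_integrand_eq_zero hf hφd hφ0 hφm (hud x) (congrFun hzero x)
  obtain ⟨b, hb, hb'⟩ := hM x
  have heq := hconst.apply_eq_of_isPreconnected isPreconnected_connectedComponent hb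
    mem_connectedComponent
  exact (hφz _).1 (heq ▸ (hφz _).2 (hc b hb').le)

end MaximumPrinciple

end

theorem mainTheorem5
    {m n : ℕ} [NeZero m]
    {M : Type*} [TopologicalSpace M] [T2Space M] [CompactSpace M]
    [ChartedSpace (EuclideanHalfSpace m) M] [IsManifold (𝓡∂ m) ∞ M]
    [RiemannianBundle (fun x : M => TangentSpace (𝓡∂ m) x)]
    [IsContMDiffRiemannianBundle (𝓡∂ m) ∞ (EuclideanSpace ℝ (Fin m))
      (fun x : M => TangentSpace (𝓡∂ m) x)]
    [MeasurableSpace M] [BorelSpace M]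
    {N : Type*} [TopologicalSpace N] [T2Space N] [SecondCountableTopology N]
    [ChartedSpace (EuclideanSpace ℝ (Fin n)) N] [IsManifold (𝓡 n) ∞ N]
    [RiemannianBundle (fun y : N => TangentSpace (𝓡 n) y)]
    [IsContMDiffRiemannianBundle (𝓡 n) ∞ (EuclideanSpace ℝ (Fin n))
      (fun y : N => TangentSpace (𝓡 n) y)]
    (hM : ((𝓡∂ m).boundary M).Nonempty)
    (hM' : ∀ x : M, (connectedComponent x ∩ (𝓡∂ m).boundary M).Nonempty)
    (p : ℝ) (hp : 2 ≤ p)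
    (u : M → N) (hu : ContMDiff (𝓡∂ m) (𝓡 n) 1 u) (hup : IsPHarmonic (n := n) (𝓡∂ m) p u)
    (f : N → ℝ) (hf : IsSmoothConvex (n := n) f) :
    BddAbove (range (f ∘ u)) ∧
      sSup (range (f ∘ u)) = sSup ((f ∘ u) '' (𝓡∂ m).boundary M) := by
  have hbdd : BddAbove (range (f ∘ u)) :=
    (isCompact_range (hf.1.continuous.comp hu.continuous)).bddAbove
  have hne : ((f ∘ u) '' (𝓡∂ m).boundary M).Nonempty := hM.image _
  have hsub : (f ∘ u) '' (𝓡∂ m).boundary M ⊆ range (f ∘ u) := image_subset_range _ _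
  refine ⟨hbdd, le_antisymm (csSup_le (hne.mono hsub) ?_) (csSup_le_csSup hbdd hne hsub)⟩
  rintro _ ⟨x, rfl⟩
  refine le_of_forall_gt_imp_ge_of_dense fun c hc => ?_
  exact hup.comp_le_of_boundary_lt hM' hp hf
    (fun b hb => (le_csSup (hbdd.mono hsub) (mem_image_of_mem _ hb)).trans_lt hc) x
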